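/- Permutations $\sigma\in S_n$ are written as words $\sigma_1\cdots\sigma_n$. Let $\mathrm{des}(\sigma)$ be the number of $i$ with $\sigma_i>\sigma_{i+1}$ and $\mathrm{LRmin}(\sigma)$ the number of left-to-right minima of $\sigma$, i.e. of $j$ such that $\sigma_i>\sigma_j$ for all $i<j$. For $\tau\in S_m$, a $\tau$-match in $\sigma$ is a block of $m$ consecutive letters $\sigma_i\sigma_{i+1}\cdots\sigma_{i+m-1}$ whose reduction (replace the $r$-th smallest letter by $r$) is $\tau$. Put $\mathrm{NM}_{\tau,0}(x,y)=1$ and, for $n\ge 1$, $$\mathrm{NM}_{\tau,n}(x,y)=\sum_{\sigma}x^{\mathrm{LRmin}(\sigma)}y^{1+\mathrm{des}(\sigma)},$$ the sum being over all $\sigma\in S_n$ that have no $\tau$-match. Let $$\mathrm{NM}_\tau(t,x,y)=\sum_{n\ge0}\mathrm{NM}_{\tau,n}(x,y)\frac{t^n}{n!}\in\mathbb{Q}[x,y][[t]],$$ and define the formal power series $U_\tau(t,y)$ and the polynomials $U_{\tau,n}(y)\in\mathbb{Q}[y]$ by $$U_\tau(t,y)=\sum_{n\ge0}U_{\tau,n}(y)\frac{t^n}{n!}=\Bigl(\sum_{n\ge0}\mathrm{NM}_{\tau,n}(1,y)\frac{t^n}{n!}\Bigr)^{-1}.$$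 **Theorem.** Let $a\ge2$ and let $\tau=\tau_1\cdots\tau_{2a}\in S_{2a}$ be the permutation with $\tau_1\tau_3\cdots\tau_{2a-1}=1\,2\cdots a$ and $\tau_2\tau_4\cdots\tau_{2a}=(2a)(2a-1)\cdots(a+1)$. Then $$\mathrm{NM}_\tau(t,x,y)=\left(\frac{1}{U_\tau(t,y)}\right)^x,$$ where, for a power series $F$ in $t$ with constant coefficient $1$, $F^x$ means $\exp(x\log F)$. Moreover $U_{\tau,0}(y)=1$, $U_{\tau,1}(y)=-y$, and for all $n\ge2$ $$\begin{aligned}U_{\tau,n}(y)={}&(1-y)\,U_{\tau,n-1}(y)-\sum_{k=0}^{\lfloor (n-2a)/(2a)\rfloor}\binom{n-(k+1)a-1}{(k+1)a-1}\,y^{(k+1)a-1}\,U_{\tau,n-2(k+1)a+1}(y)\\&+\sum_{k=0}^{\lfloor (n-2a-2)/(2a)\rfloor}\binom{n-(k+1)a-2}{(k+1)a}\,y^{(k+1)a}\,U_{\tau,n-2(k+1)a-1}(y),\end{aligned}$$ where a sum whose upper limit is negative is empty. -/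

import Mathlib

noncomputable section

namespace ConsecutivePattern

/-- The reduction of a finite word with distinct letters: the `i`-th smallest letter is replaced
by `i`, that is, every letter is replaced by the number of letters that do not exceed it. -/
def red {m : ℕ} (w : Fin m → ℕ) (p : Fin m) : ℕ :=
  (Finset.univ.filter fun q : Fin m => w q ≤ w p).card

/-- The one-line notation `σ₁ σ₂ … σₙ` of a permutation of `{1, …, n}`: positions are counted
from `0` (in `Fin n`), letters from `1`. -/
def letter {n : ℕ} (σ : Equiv.Perm (Fin n)) (p : Fin n) : ℕ := (σ p : ℕ) + 1

/-- `σ` has a `τ`-match starting at the (0-based) position `i`: the reduction of the `m`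
consecutive letters of `σ` that start at position `i` is `τ`. -/
def MatchAt {m n : ℕ} (τ : Equiv.Perm (Fin m)) (σ : Equiv.Perm (Fin n)) (i : ℕ) : Prop :=
  ∃ h : i + m ≤ n,
    red (fun p : Fin m => letter σ ⟨i + p, by have := p.isLt; omega⟩) = letter τ

open Classical in
/-- The number of `τ`-matches in `σ`. -/
def mch {m n : ℕ} (τ : Equiv.Perm (Fin m)) (σ : Equiv.Perm (Fin n)) : ℕ :=
  ((Finset.range (n + 1)).filter fun i => MatchAt τ σ i).card

/-- The permutations of `{1, …, n}` without `τ`-matches. -/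
def noMatch {m : ℕ} (τ : Equiv.Perm (Fin m)) (n : ℕ) : Finset (Equiv.Perm (Fin n)) :=
  Finset.univ.filter fun σ => mch τ σ = 0

open Classical in
/-- The number of descents of `σ`. -/
def des {n : ℕ} (σ : Equiv.Perm (Fin n)) : ℕ :=
  (Finset.univ.filter fun i : Fin n => ∃ h : (i : ℕ) + 1 < n, σ ⟨(i : ℕ) + 1, h⟩ < σ i).card

open Classical in
/-- The number of left-to-right minima of `σ`. -/
def lrmin {n : ℕ} (σ : Equiv.Perm (Fin n)) : ℕ :=
  (Finset.univ.filter fun j : Fin n => ∀ i : Fin n, i < j → σ j < σ i).card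

/-- The ring `ℚ[y]`. -/
abbrev Ry : Type := Polynomial ℚ

/-- The ring `ℚ[y][x]` of polynomials in `x` and `y`. -/
abbrev Rxy : Type := Polynomial Ry

/-- The variable `y`. -/
abbrev y : Ry := Polynomial.X

/-- The variable `x`. -/
abbrev x : Rxy := Polynomial.X

/-- The polynomial `NM_{τ,n}(x,y)`, the sum of `x ^ LRmin(σ) * y ^ (1 + des(σ))` over all
permutations `σ` of `{1, …, n}` without `τ`-matches. For `n = 0` it is `1`, the usual
convention for the empty permutation. -/
def NMpoly {m : ℕ} (τ : Equiv.Perm (Fin m)) : ℕ → Rxy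
  | 0 => 1
  | n + 1 => ∑ σ ∈ noMatch τ (n + 1), x ^ lrmin σ * Polynomial.C (y ^ (1 + des σ))

/-- The exponential generating function `∑ₙ f n * t ^ n / n!` in the variable `t`. -/
def egf {R : Type*} [CommRing R] [Algebra ℚ R] (f : ℕ → R) : PowerSeries R :=
  PowerSeries.mk fun n => (1 / (n.factorial : ℚ)) • f n

/-- The generating function `NM_τ(t,x,y)`, a power series in `t` over `ℚ[y][x]`. -/
def NM {m : ℕ} (τ : Equiv.Perm (Fin m)) : PowerSeries Rxy := egf (NMpoly τ)

/-- The power series `U_τ(t,y) = 1 / (∑ₙ NM_{τ,n}(1,y) * t ^ n / n!)` over `ℚ[y]`. The series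
that is inverted has constant coefficient `1`. -/
def U {m : ℕ} (τ : Equiv.Perm (Fin m)) : PowerSeries Ry :=
  PowerSeries.invOfUnit (egf fun n => Polynomial.eval 1 (NMpoly τ n)) 1

/-- The polynomials `U_{τ,n}(y)`, with `U_τ(t,y) = ∑ₙ U_{τ,n}(y) * t ^ n / n!`. -/
def Upoly {m : ℕ} (τ : Equiv.Perm (Fin m)) (n : ℕ) : Ry :=
  (n.factorial : ℚ) • PowerSeries.coeff n (U τ)

/-- The formal power `F ^ r = exp (r * log F)` of a power series `F` with constant
coefficient `1`, for an exponent `r` in the coefficient ring. -/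
def formalPow {R : Type*} [CommRing R] [Algebra ℚ R] (F : PowerSeries R) (r : R) :
    PowerSeries R :=
  (PowerSeries.exp R).subst (PowerSeries.C r * PowerSeries.logOf F)

/-- The word of `τ_a`, with 0-based positions and letters: the letters in the positions
`0, 2, 4, …` are `0, 1, …, a - 1` and those in the positions `1, 3, 5, …` are
`2 * a - 1, 2 * a - 2, …, a`. -/
def tauFun (a : ℕ) (p : Fin (2 * a)) : Fin (2 * a) :=
  if (p : ℕ) % 2 = 0 then ⟨(p : ℕ) / 2, by have := p.isLt; omega⟩
  else ⟨2 * a - 1 - (p : ℕ) / 2, by have := p.isLt; omega⟩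

theorem tauFun_injective (a : ℕ) : Function.Injective (tauFun a) := by
  intro p q h
  have hp := p.isLt
  have hq := q.isLt
  unfold tauFun at h
  apply Fin.ext
  split_ifs at h <;> simp only [Fin.mk.injEq] at h <;> omega

/-- The permutation `τ_a` of `{1, …, 2a}`. -/
def tau (a : ℕ) : Equiv.Perm (Fin (2 * a)) :=
  Equiv.ofBijective (tauFun a) (Finite.injective_iff_bijective.mp (tauFun_injective a))

/-- The letters of `τ_a` in the odd positions `1, 3, …, 2a - 1` are `1, 2, …, a`. -/
theorem letter_tau_odd_position (a j : ℕ) (hj : j < a) :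
    letter (tau a) ⟨2 * j, by omega⟩ = j + 1 := by
  simp [letter, tau, tauFun]

/-- The letters of `τ_a` in the even positions `2, 4, …, 2a` are `2a, 2a - 1, …, a + 1`. -/
theorem letter_tau_even_position (a j : ℕ) (hj : j < a) :
    letter (tau a) ⟨2 * j + 1, by omega⟩ = 2 * a - j := by
  have h : (2 * j + 1) % 2 ≠ 0 := by omega
  simp only [letter, tau, tauFun, Equiv.ofBijective_apply, h, if_false]
  omega

end ConsecutivePattern

end

/-! Let A_x be the exponential generating function of the avoiding words, weighted by x^LRmin
y^(1+des), and A = A_1. All weights used depend only on the relative order of the letters, so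
cutting words in two corresponds to multiplying exponential generating functions (`wordSum_conv`).

The power law rests on τ beginning with its smallest letter: no match runs across the minimum of a
word from the left. Cutting just before the minimum therefore factors the weight
(`avoidWeight_append`), and the left factor has one left-to-right minimum fewer. With M the series
of avoiding words that begin with their minimum, differentiated once, this says A_x' = x M A_x and
A' = M A. Since A^x solves the first equation with the same constant term, A_x = A^x.

The recursion is a cluster computation of U = 1/A. Copies of `tau a` that share at least two letters
are shifted by an even amount and unite to a longer `tau m` (`Starts.not_starts_odd`,
`Starts.glue`), so every cluster has the shape `tau (k + 1)`. The signed numbers of coverings, with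
1 put at k = 0, have generating function 1 - q^(a-1)/(1+q+...+q^(a-1)) = (1-q^(a-1))/(1-q^a), whose
coefficients are `coverSign`. A chain consists of ascents of weight -y and patterns `tau (k + 1)` of
weight `coverSign a k * y ^ k`, consecutive pieces sharing one letter. If C is the series of chains,
then y C A = A - 1, already word by word (`y_mul_conv`); hence U = 1 - y C.

A word with nonzero chain weight begins with its minimum. If its first piece is `tau (k + 1)` on n
letters, the odd positions of this piece carry the k + 1 smallest letters, its last letter is the
next smallest, and the other k letters are arbitrary among the remaining n - k - 2. This gives the
binomial coefficients (`wordSum_startWeight`); `coverSign` keeps only k ≡ 0 and k ≡ -1 mod a, and k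
= 0 together with the ascents of weight -y yields the factor 1 - y. -/

namespace ConsecutivePattern

open Finset

/-! ### Words with distinct letters and deconcatenation -/

/-- The words without repeated letters whose set of letters is `S`. -/
def words (S : Finset ℕ) : Finset (List ℕ) := S.val.lists.toFinset

theorem mem_words {S : Finset ℕ} {l : List ℕ} : l ∈ words S ↔ l.Nodup ∧ l.toFinset = S := by
  rw [words, Multiset.mem_toFinset, Multiset.mem_lists_iff]
  constructor
  · intro h
    have hn : l.Nodup := by
      have := S.nodup
      rw [h] at this
      exact this
    refine ⟨hn, ?_⟩
    ext z
    rw [List.mem_toFinset, ← Finset.mem_val, h]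
    rfl
  · rintro ⟨hn, rfl⟩
    rw [List.toFinset_val, hn.dedup]
    rfl

theorem length_of_mem_words {S : Finset ℕ} {l : List ℕ} (h : l ∈ words S) :
    l.length = #S := by
  obtain ⟨hn, rfl⟩ := mem_words.1 h
  exact (List.toFinset_card_of_nodup hn).symm

theorem mem_of_mem_words {S : Finset ℕ} {l : List ℕ} (h : l ∈ words S) {z : ℕ} :
    z ∈ l ↔ z ∈ S := by
  obtain ⟨hn, rfl⟩ := mem_words.1 h
  exact List.mem_toFinset.symm

theorem words_empty : words ∅ = {[]} := by
  ext l
  rw [mem_words, mem_singleton]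
  constructor
  · rintro ⟨-, h⟩
    exact List.toFinset_eq_empty_iff l |>.1 h
  · rintro rfl
    simp

theorem cons_mem_words {S : Finset ℕ} {z : ℕ} {l : List ℕ} :
    z :: l ∈ words S ↔ z ∈ S ∧ l ∈ words (S.erase z) := by
  simp only [mem_words, List.nodup_cons, List.toFinset_cons]
  constructor
  · rintro ⟨⟨hz, hn⟩, rfl⟩
    refine ⟨mem_insert_self _ _, hn, ?_⟩
    rw [erase_insert (by simpa using hz)]
  · rintro ⟨hz, hn, h⟩
    refine ⟨⟨fun h' => ?_, hn⟩, by rw [h, insert_erase hz]⟩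
    have := List.mem_toFinset.2 h'
    rw [h] at this
    exact notMem_erase _ _ this

section sums

variable {R : Type*} [CommRing R]

/-- The sum of `w` over the words with set of letters `S`. -/
def wordSum (w : List ℕ → R) (S : Finset ℕ) : R := ∑ l ∈ words S, w l

theorem wordSum_congr {w v : List ℕ → R} {S : Finset ℕ} (h : ∀ l ∈ words S, w l = v l) :
    wordSum w S = wordSum v S := sum_congr rfl h

theorem wordSum_cons (w : List ℕ → R) {S : Finset ℕ} (hS : S.Nonempty) :
    wordSum w S = ∑ z ∈ S, wordSum (fun l => w (z :: l)) (S.erase z) := by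
  unfold wordSum
  rw [sum_sigma']
  symm
  refine sum_bij (fun q _ => q.1 :: q.2) ?_ ?_ ?_ ?_
  · rintro ⟨z, l⟩ h
    rw [mem_sigma] at h
    exact cons_mem_words.2 h
  · rintro ⟨z, l⟩ - ⟨z', l'⟩ - h
    simp only [List.cons.injEq] at h
    obtain ⟨rfl, rfl⟩ := h
    rfl
  · intro l hl
    cases l with
    | nil =>
      have := length_of_mem_words hl
      simp at this
      exact absurd (card_eq_zero.1 this.symm) hS.ne_empty
    | cons z l =>
      exact ⟨⟨z, l⟩, mem_sigma.2 (cons_mem_words.1 hl), rfl⟩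
  · intros
    rfl

/-- A word with a marked cut is the same as a set T of letters together with a word on T and a word
on its complement. -/
theorem wordSum_splits (f : List ℕ → List ℕ → R) (S : Finset ℕ) :
    wordSum (fun l => ∑ k ∈ range (l.length + 1), f (l.take k) (l.drop k)) S =
      ∑ T ∈ S.powerset, wordSum (fun l₁ => wordSum (f l₁) (S \ T)) T := by
  unfold wordSum
  simp_rw [sum_sigma']
  refine sum_bij (fun q _ => ⟨(q.1.take q.2).toFinset, q.1.take q.2, q.1.drop q.2⟩) ?_ ?_ ?_ ?_
  · rintro ⟨l, k⟩ h
    rw [mem_sigma] at h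
    obtain ⟨hn, rfl⟩ := mem_words.1 h.1
    have h1 : (l.take k ++ l.drop k).Nodup := by rwa [List.take_append_drop]
    rw [List.nodup_append'] at h1
    simp only [mem_sigma, mem_powerset, mem_words]
    refine ⟨fun z hz => ?_, ⟨h1.1, trivial⟩, h1.2.1, ?_⟩
    · rw [List.mem_toFinset] at hz ⊢
      exact List.mem_of_mem_take hz
    · ext z
      rw [mem_sdiff, List.mem_toFinset, List.mem_toFinset, List.mem_toFinset]
      constructor
      · intro hz
        exact ⟨List.mem_of_mem_drop hz, fun h' => h1.2.2 h' hz⟩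
      · rintro ⟨hz, hz'⟩
        rw [← List.take_append_drop k l, List.mem_append] at hz
        exact hz.resolve_left hz'
  · rintro ⟨l, k⟩ h ⟨l', k'⟩ h' heq
    simp only [mem_sigma, mem_range] at h h'
    simp only [Sigma.mk.injEq, heq_eq_eq] at heq
    obtain ⟨-, h1, h2⟩ := heq
    have hl : l = l' := by
      rw [← List.take_append_drop k l, ← List.take_append_drop k' l', h1, h2]
    subst hl
    have h3 := congrArg List.length h1
    rw [List.length_take, List.length_take] at h3
    have : k = k' := by omega
    rw [this]
  · rintro ⟨T, l₁, l₂⟩ h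
    simp only [mem_sigma, mem_powerset, mem_words] at h
    obtain ⟨hT, ⟨hn1, rfl⟩, hn2, h2⟩ := h
    refine ⟨⟨l₁ ++ l₂, l₁.length⟩, ?_, ?_⟩
    · simp only [mem_sigma, mem_words, mem_range, List.length_append]
      refine ⟨⟨?_, ?_⟩, by omega⟩
      · rw [List.nodup_append']
        refine ⟨hn1, hn2, fun z hz hz' => ?_⟩
        have := List.mem_toFinset.2 hz'
        rw [h2, mem_sdiff] at this
        exact this.2 (List.mem_toFinset.2 hz)
      · rw [List.toFinset_append, h2, union_sdiff_of_subset hT]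
    · simp
  · intros
    rfl

/-- `w` only depends on the relative order of the letters. -/
def OrderInvariant (w : List ℕ → R) : Prop :=
  ∀ (l : List ℕ) (f : ℕ → ℕ), (∀ u ∈ l, ∀ v ∈ l, u < v ↔ f u < f v) → w (l.map f) = w l

theorem OrderInvariant.wordSum_image {w : List ℕ → R} (hw : OrderInvariant w) (S : Finset ℕ)
    (f : ℕ → ℕ) (hf : ∀ u ∈ S, ∀ v ∈ S, u < v ↔ f u < f v) :
    wordSum w (S.image f) = wordSum w S := by
  have hinj : ∀ u ∈ S, ∀ v ∈ S, f u = f v → u = v := by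
    intro u hu v hv h
    have h1 := hf u hu v hv
    have h2 := hf v hv u hu
    omega
  unfold wordSum
  symm
  refine sum_bij (fun l _ => l.map f) ?_ ?_ ?_ ?_
  · intro l hl
    obtain ⟨hn, rfl⟩ := mem_words.1 hl
    rw [mem_words]
    refine ⟨?_, ?_⟩
    · rw [List.nodup_map_iff_inj_on hn]
      intro u hu v hv
      exact hinj u (List.mem_toFinset.2 hu) v (List.mem_toFinset.2 hv)
    · ext z
      simp
  · intro l hl l' hl' h
    have hlen : l.length = l'.length := by
      rw [length_of_mem_words hl, length_of_mem_words hl']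
    refine List.ext_getElem hlen fun i h1 h2 => ?_
    have h3 : (l.map f)[i]'(by simpa using h1) = (l'.map f)[i]'(by simpa using h2) := by
      simp only [h]
    rw [List.getElem_map, List.getElem_map] at h3
    exact hinj _ ((mem_of_mem_words hl).1 (List.getElem_mem _)) _
      ((mem_of_mem_words hl').1 (List.getElem_mem _)) h3
  · intro l hl
    obtain ⟨hn, h⟩ := mem_words.1 hl
    have hex : ∀ z ∈ l, ∃ u ∈ S, f u = z := fun z hz => by
      have := List.mem_toFinset.2 hz
      rw [h] at this
      exact mem_image.1 this
    choose! g hg hfg using hex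
    have hmap : (l.map g).map f = l := by
      rw [List.map_map]
      exact List.map_congr_left (fun z hz => hfg z hz) |>.trans (List.map_id l)
    refine ⟨l.map g, ?_, hmap⟩
    rw [mem_words]
    refine ⟨?_, ?_⟩
    · apply List.Nodup.of_map f
      rw [hmap]
      exact hn
    · ext u
      rw [List.mem_toFinset, List.mem_map]
      constructor
      · rintro ⟨z, hz, rfl⟩
        exact hg z hz
      · intro hu
        have h1 : f u ∈ l := by
          rw [← List.mem_toFinset, h]
          exact mem_image_of_mem f hu
        exact ⟨f u, h1, hinj _ (hg _ h1) _ hu (hfg _ h1)⟩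
  · intro l hl
    refine (hw l f fun u hu v hv => ?_).symm
    exact hf u ((mem_of_mem_words hl).1 hu) v ((mem_of_mem_words hl).1 hv)

theorem sum_rank {M : Type*} [AddCommMonoid M] (h : ℕ → M) (S : Finset ℕ) :
    ∑ z ∈ S, h (#{s ∈ S | s < z}) = ∑ j ∈ range #S, h j := by
  induction S using Finset.induction_on_max with
  | empty => simp
  | insert m S hm ih =>
    have hmS : m ∉ S := fun h' => lt_irrefl _ (hm m h')
    rw [sum_insert hmS, card_insert_of_notMem hmS, sum_range_succ, add_comm, ← ih]
    congr 1
    · refine sum_congr rfl fun z hz => ?_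
      rw [filter_insert, if_neg (by have := hm z hz; omega)]
    · rw [filter_insert, if_neg (lt_irrefl _), filter_true_of_mem hm]

theorem image_rank (S : Finset ℕ) :
    S.image (fun z => #{s ∈ S | s < z}) = range #S := by
  induction S using Finset.induction_on_max with
  | empty => simp
  | insert m S hm ih =>
    have hmS : m ∉ S := fun h' => lt_irrefl _ (hm m h')
    rw [image_insert, card_insert_of_notMem hmS, range_add_one, ← ih]
    congr 1
    · rw [filter_insert, if_neg (lt_irrefl _), filter_true_of_mem hm]
    · refine image_congr fun z hz => ?_
      rw [filter_insert, if_neg (by have := hm z hz; omega)]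

/-- Replacing each letter by its rank is order preserving and maps `S` onto an initial segment. -/
theorem OrderInvariant.wordSum_eq {w : List ℕ → R} (hw : OrderInvariant w) (S : Finset ℕ) :
    wordSum w S = wordSum w (range #S) := by
  rw [← image_rank S]
  refine (hw.wordSum_image S _ fun u hu v hv => ?_).symm
  constructor
  · intro h
    refine card_lt_card ⟨fun s hs => ?_, fun h' => ?_⟩
    · rw [mem_filter] at hs ⊢
      exact ⟨hs.1, hs.2.trans h⟩
    · have := h' (mem_filter.2 ⟨hu, h⟩)
      exact lt_irrefl _ (mem_filter.1 this).2
  · intro h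
    by_contra hvu
    refine absurd (card_le_card (fun s hs => ?_)) (not_le.2 h)
    rw [mem_filter] at hs ⊢
    exact ⟨hs.1, by omega⟩

/-- The convolution of two functions on words along deconcatenation. -/
def conv (w v : List ℕ → R) (l : List ℕ) : R :=
  ∑ k ∈ range (l.length + 1), w (l.take k) * v (l.drop k)

theorem wordSum_conv {w v : List ℕ → R} (hw : OrderInvariant w) (hv : OrderInvariant v)
    (n : ℕ) : wordSum (conv w v) (range n) =
      ∑ k ∈ range (n + 1), (n.choose k : R) *
        (wordSum w (range k) * wordSum v (range (n - k))) := by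
  unfold conv
  rw [wordSum_splits (fun l₁ l₂ => w l₁ * v l₂)]
  have h : ∀ T ∈ (range n).powerset,
      wordSum (fun l₁ => wordSum (fun l₂ => w l₁ * v l₂) (range n \ T)) T =
        wordSum w (range #T) * wordSum v (range (n - #T)) := by
    intro T hT
    rw [mem_powerset] at hT
    have h1 : #(range n \ T) = n - #T := by rw [card_sdiff_of_subset hT, card_range]
    rw [← h1, ← hw.wordSum_eq, ← hv.wordSum_eq]
    unfold wordSum
    rw [sum_mul_sum]
  rw [sum_congr rfl h, sum_powerset_apply_card
    (fun k => wordSum w (range k) * wordSum v (range (n - k)))]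
  simp [nsmul_eq_mul]

end sums

/-! ### Exponential generating functions and formal powers -/

section series

variable {R : Type*} [CommRing R] [Algebra ℚ R]

theorem coeff_egf (f : ℕ → R) (n : ℕ) :
    PowerSeries.coeff n (egf f) = (1 / (n.factorial : ℚ)) • f n := by
  rw [egf, PowerSeries.coeff_mk]

theorem factorial_smul_coeff_egf (f : ℕ → R) (n : ℕ) :
    (n.factorial : ℚ) • PowerSeries.coeff n (egf f) = f n := by
  rw [coeff_egf, smul_smul, mul_one_div_cancel (by positivity), one_smul]

theorem egf_mul_egf (f g : ℕ → R) :
    egf f * egf g = egf fun n => ∑ k ∈ range (n + 1), (n.choose k : R) * (f k * g (n - k)) := by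
  ext n
  rw [PowerSeries.coeff_mul, coeff_egf, Nat.sum_antidiagonal_eq_sum_range_succ_mk, smul_sum]
  refine sum_congr rfl fun k hk => ?_
  have hk' : k ≤ n := by rw [mem_range] at hk; omega
  simp only [coeff_egf]
  rw [smul_mul_smul_comm]
  have h1 : ((n.choose k : R)) = algebraMap ℚ R (n.choose k : ℚ) := by simp
  rw [h1, ← Algebra.smul_def, smul_smul]
  congr 1
  rw [Nat.cast_choose ℚ hk']
  have : (n.factorial : ℚ) ≠ 0 := by positivity
  field_simp

theorem derivative_egf (f : ℕ → R) :
    PowerSeries.derivative R (egf f) = egf fun n => f (n + 1) := by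
  ext n
  rw [PowerSeries.coeff_derivative, coeff_egf, coeff_egf]
  have h1 : ((n : R) + 1) = algebraMap ℚ R ((n : ℚ) + 1) := by simp
  rw [h1, mul_comm, ← Algebra.smul_def, smul_smul]
  congr 1
  rw [Nat.factorial_succ]
  have : (n.factorial : ℚ) ≠ 0 := by positivity
  push_cast
  field_simp

theorem mul_derivative_logOf {F : PowerSeries R} (hF : PowerSeries.constantCoeff F = 1) :
    F * PowerSeries.derivative R (PowerSeries.logOf F) = PowerSeries.derivative R F := by
  have hs : PowerSeries.HasSubst (F - 1) :=
    PowerSeries.HasSubst.of_constantCoeff_zero' (by simp [hF])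
  -- The relation (1 + X) log' = 1 is carried along the substitution X ↦ F - 1, which avoids
  -- dividing by F.
  have h1 : (1 + PowerSeries.X) * PowerSeries.derivative R (PowerSeries.log R) = 1 := by
    rw [PowerSeries.deriv_log]
    ext n
    cases n with
    | zero => simp [add_mul]
    | succ n => simp [add_mul, PowerSeries.coeff_succ_X_mul, pow_succ, PowerSeries.coeff_one]
  have h2 := congrArg (PowerSeries.substAlgHom (R := R) hs) h1
  rw [map_mul, map_add, map_one, PowerSeries.coe_substAlgHom, PowerSeries.subst_X hs,
    add_sub_cancel] at h2
  rw [PowerSeries.logOf_eq, PowerSeries.derivative_subst hs, map_sub,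
    PowerSeries.derivative_one, sub_zero, ← mul_assoc, h2, one_mul]

theorem constantCoeff_formalPow {F : PowerSeries R} (hF : PowerSeries.constantCoeff F = 1)
    (r : R) : PowerSeries.constantCoeff (formalPow F r) = 1 := by
  have h0 : PowerSeries.constantCoeff (PowerSeries.C r * PowerSeries.logOf F) = 0 := by
    rw [map_mul, PowerSeries.constantCoeff_logOf hF, mul_zero]
  have hs : PowerSeries.HasSubst (PowerSeries.C r * PowerSeries.logOf F) :=
    PowerSeries.HasSubst.of_constantCoeff_zero' h0
  -- Subtracting 1 from exp makes its constant coefficient zero, as the substitution lemma requires.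
  have h := PowerSeries.constantCoeff_subst_eq_zero (a := PowerSeries.C r * PowerSeries.logOf F)
    h0 (PowerSeries.exp R - 1) (by simp)
  rw [← PowerSeries.coe_substAlgHom hs, map_sub, map_one, PowerSeries.coe_substAlgHom] at h
  have h' : PowerSeries.constantCoeff (formalPow F r - 1) = 0 := h
  rw [map_sub, map_one, sub_eq_zero] at h'
  exact h'

theorem mul_derivative_formalPow {F : PowerSeries R} (hF : PowerSeries.constantCoeff F = 1)
    (r : R) : F * PowerSeries.derivative R (formalPow F r) =
      PowerSeries.C r * PowerSeries.derivative R F * formalPow F r := by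
  have h0 : PowerSeries.constantCoeff (PowerSeries.C r * PowerSeries.logOf F) = 0 := by
    rw [map_mul, PowerSeries.constantCoeff_logOf hF, mul_zero]
  have hs : PowerSeries.HasSubst (PowerSeries.C r * PowerSeries.logOf F) :=
    PowerSeries.HasSubst.of_constantCoeff_zero' h0
  rw [formalPow, PowerSeries.derivative_subst hs, PowerSeries.derivative_exp, Derivation.leibniz,
    PowerSeries.derivative_C, smul_zero, add_zero, smul_eq_mul, ← mul_derivative_logOf hF]
  ring

/-- The linear equation determines the coefficients one after another, because n + 1 is invertible
in a ℚ-algebra. -/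
theorem eq_of_derivative_eq_mul {G H h : PowerSeries R}
    (hc : PowerSeries.constantCoeff G = PowerSeries.constantCoeff H)
    (hG : PowerSeries.derivative R G = h * G) (hH : PowerSeries.derivative R H = h * H) :
    G = H := by
  ext n
  induction n using Nat.strong_induction_on with
  | _ n ih =>
    cases n with
    | zero => simpa using hc
    | succ n =>
      have h1 : PowerSeries.coeff n (h * G) = PowerSeries.coeff n (h * H) := by
        rw [PowerSeries.coeff_mul, PowerSeries.coeff_mul]
        refine sum_congr rfl fun q hq => ?_
        rw [ih q.2 (by rw [HasAntidiagonal.mem_antidiagonal] at hq; omega)]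
      rw [← hG, ← hH, PowerSeries.coeff_derivative, PowerSeries.coeff_derivative] at h1
      have hu : IsUnit ((n : R) + 1) := by
        have h2 : ((n : R) + 1) = algebraMap ℚ R ((n : ℚ) + 1) := by simp
        rw [h2]
        exact (IsUnit.mk0 _ (by positivity)).map _
      exact hu.mul_right_cancel h1

end series

/-! ### Copies of the pattern at the start of a word, and their overlaps -/

/-- The first `2 * m` letters of the word are in the same relative order as those of `tau m`. -/
def Starts : ℕ → List ℕ → Prop
  | 0, _ => True
  | 1, z₁ :: z₂ :: _ => z₁ < z₂
  | m + 2, z₁ :: z₂ :: z₃ :: z₄ :: t => z₁ < z₃ ∧ z₄ < z₂ ∧ Starts (m + 1) (z₃ :: z₄ :: t)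
  | _ + 1, _ => False

theorem starts_zero (l : List ℕ) : Starts 0 l := by simp [Starts]

theorem starts_one {z₁ z₂ : ℕ} {t : List ℕ} : Starts 1 (z₁ :: z₂ :: t) ↔ z₁ < z₂ := by
  simp [Starts]

theorem starts_add_two {m z₁ z₂ z₃ z₄ : ℕ} {t : List ℕ} :
    Starts (m + 2) (z₁ :: z₂ :: z₃ :: z₄ :: t) ↔
      z₁ < z₃ ∧ z₄ < z₂ ∧ Starts (m + 1) (z₃ :: z₄ :: t) := by
  simp [Starts]

theorem Starts.two_mul_le_length {m : ℕ} {l : List ℕ} (h : Starts m l) : 2 * m ≤ l.length := by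
  induction m using Nat.strong_induction_on generalizing l with
  | _ m ih =>
    match m, l with
    | 0, _ => omega
    | 1, z₁ :: z₂ :: _ => simp
    | 1, [] => simp [Starts] at h
    | 1, [_] => simp [Starts] at h
    | m + 2, z₁ :: z₂ :: z₃ :: z₄ :: t =>
      have := ih (m + 1) (by omega) (starts_add_two.1 h).2.2
      simp only [List.length_cons] at this ⊢
      omega
    | m + 2, [] => simp [Starts] at h
    | m + 2, [_] => simp [Starts] at h
    | m + 2, [_, _] => simp [Starts] at h
    | m + 2, [_, _, _] => simp [Starts] at h

theorem starts_add_two_iff {m : ℕ} {l : List ℕ} : Starts (m + 2) l ↔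
    ∃ z₁ z₂ z₃ z₄ t, l = z₁ :: z₂ :: z₃ :: z₄ :: t ∧ z₁ < z₃ ∧ z₄ < z₂ ∧
      Starts (m + 1) (z₃ :: z₄ :: t) := by
  constructor
  · intro h
    match l with
    | z₁ :: z₂ :: z₃ :: z₄ :: t => exact ⟨_, _, _, _, _, rfl, starts_add_two.1 h⟩
    | [] => simp [Starts] at h
    | [_] => simp [Starts] at h
    | [_, _] => simp [Starts] at h
    | [_, _, _] => simp [Starts] at h
  · rintro ⟨_, _, _, _, _, rfl, h⟩
    exact starts_add_two.2 h

theorem starts_one_iff {l : List ℕ} : Starts 1 l ↔ ∃ z₁ z₂ t, l = z₁ :: z₂ :: t ∧ z₁ < z₂ := by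
  constructor
  · intro h
    match l with
    | z₁ :: z₂ :: t => exact ⟨_, _, _, rfl, starts_one.1 h⟩
    | [] => simp [Starts] at h
    | [_] => simp [Starts] at h
  · rintro ⟨_, _, _, rfl, h⟩
    exact starts_one.2 h

theorem Starts.of_succ {m : ℕ} {l : List ℕ} (h : Starts (m + 1) l) : Starts m l := by
  induction m generalizing l with
  | zero => exact starts_zero l
  | succ m ih =>
    obtain ⟨z₁, z₂, z₃, z₄, t, rfl, h1, h2, h3⟩ := starts_add_two_iff.1 h
    cases m with
    | zero =>
      have := starts_one.1 h3
      exact starts_one.2 (by omega)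
    | succ m => exact starts_add_two.2 ⟨h1, h2, ih h3⟩

theorem Starts.mono {m m' : ℕ} {l : List ℕ} (h : Starts m l) (hm : m' ≤ m) : Starts m' l := by
  induction hm with
  | refl => exact h
  | step _ ih => exact ih h.of_succ

theorem Starts.drop {m j : ℕ} {l : List ℕ} (h : Starts m l) :
    Starts (m - j) (l.drop (2 * j)) := by
  induction j generalizing m l with
  | zero => simpa using h
  | succ j ih =>
    match m with
    | 0 => rw [Nat.zero_sub]; exact starts_zero _
    | 1 => rw [show 1 - (j + 1) = 0 by omega]; exact starts_zero _
    | m + 2 =>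
      obtain ⟨z₁, z₂, z₃, z₄, t, rfl, h1, h2, h3⟩ := starts_add_two_iff.1 h
      have := ih h3
      rw [show m + 2 - (j + 1) = m + 1 - j by omega, show 2 * (j + 1) = 2 * j + 2 by omega]
      simpa using this

/-- The pattern is defined by inequalities between consecutive pairs of letters. Since j < m, the
two copies share a whole pair, so no inequality is missing at the seam. -/
theorem Starts.glue {m n j : ℕ} {l : List ℕ} (h : Starts m l) (hj : j < m)
    (hn : Starts n (l.drop (2 * j))) : Starts (j + n) l := by
  induction j generalizing m l with
  | zero => simpa using hn
  | succ j ih =>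
    match m, hj with
    | m + 2, hj =>
      obtain ⟨z₁, z₂, z₃, z₄, t, rfl, h1, h2, h3⟩ := starts_add_two_iff.1 h
      have h4 := ih h3 (by omega) (by
        rw [show 2 * (j + 1) = 2 * j + 2 by omega] at hn
        simpa using hn)
      rw [show j + 1 + n = (j + n) + 1 by omega]
      cases hq : j + n with
      | zero => exact h.mono (by omega)
      | succ q =>
        rw [hq] at h4
        exact starts_add_two.2 ⟨h1, h2, h4⟩

theorem Starts.descent {m : ℕ} {l : List ℕ} (h : Starts (m + 2) l) :
    ¬ Starts 1 (l.drop 1) := by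
  obtain ⟨z₁, z₂, z₃, z₄, t, rfl, h1, h2, h3⟩ := starts_add_two_iff.1 h
  have h4 := starts_one.1 (h3.mono (m' := 1) (by omega))
  intro h5
  have := starts_one.1 h5
  omega

/-- Inside a copy the odd 0-based positions are descents, whereas every copy starts with an ascent;
this excludes odd shifts. -/
theorem Starts.not_starts_odd {m j : ℕ} {l : List ℕ} (h : Starts m l) (hj : j + 1 < m) :
    ¬ Starts 1 (l.drop (2 * j + 1)) := by
  have h1 := (h.drop (j := j))
  obtain ⟨q, hq⟩ : ∃ q, m - j = q + 2 := ⟨m - j - 2, by omega⟩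
  rw [hq] at h1
  have := h1.descent
  rwa [List.drop_drop] at this

/-- The first letter of a copy of `tau (k + 1)` is smaller than its other letters. -/
theorem Starts.lt_of_mem {k z : ℕ} {t : List ℕ} (h : Starts (k + 1) (z :: t)) :
    ∀ u ∈ t.take (2 * k + 1), z < u := by
  induction k generalizing z t with
  | zero =>
    obtain ⟨z₁, z₂, s, hs, h1⟩ := starts_one_iff.1 h
    simp only [List.cons.injEq] at hs
    obtain ⟨rfl, rfl⟩ := hs
    simpa using h1
  | succ k ih =>
    obtain ⟨z₁, z₂, z₃, z₄, s, hs, h1, h2, h3⟩ := starts_add_two_iff.1 h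
    simp only [List.cons.injEq] at hs
    obtain ⟨rfl, rfl⟩ := hs
    have h4 := ih h3
    have h5 := starts_one.1 (h.mono (m' := 1) (by omega))
    intro u hu
    rw [show 2 * (k + 1) + 1 = (2 * k + 1) + 2 by omega] at hu
    simp only [List.take_succ_cons, List.mem_cons] at hu
    rcases hu with rfl | rfl | hu
    · exact h5
    · exact h1
    · exact h1.trans (h4 u (by simpa using hu))

theorem starts_take_iff {m i : ℕ} {l : List ℕ} (hi : 2 * m ≤ i) :
    Starts m (l.take i) ↔ Starts m l := by
  induction m using Nat.strong_induction_on generalizing i l with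
  | _ m ih =>
    match m, i, hi with
    | 0, _, _ => simp [starts_zero]
    | 1, i + 2, _ =>
      match l with
      | z₁ :: z₂ :: _ => simp [Starts]
      | [] => simp
      | [_] => simp
    | m + 2, i + 4, hi =>
      match l with
      | z₁ :: z₂ :: z₃ :: z₄ :: t =>
        have := ih (m + 1) (by omega) (i := i + 2) (l := z₃ :: z₄ :: t) (by omega)
        simp only [List.take_succ_cons] at this ⊢
        rw [starts_add_two, starts_add_two, this]
      | [] => simp
      | [_] => simp
      | [_, _] => simp
      | [_, _, _] => simp

theorem starts_map {f : ℕ → ℕ} {l : List ℕ} (hf : ∀ u ∈ l, ∀ v ∈ l, u < v ↔ f u < f v) (m : ℕ) :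
    Starts m (l.map f) ↔ Starts m l := by
  induction m using Nat.strong_induction_on generalizing l with
  | _ m ih =>
    match m, l with
    | 0, _ => simp [starts_zero]
    | 1, z₁ :: z₂ :: _ =>
      simp only [List.map_cons]
      rw [starts_one, starts_one, hf z₁ (by simp) z₂ (by simp)]
    | 1, [] => simp
    | 1, [_] => simp [Starts]
    | m + 2, z₁ :: z₂ :: z₃ :: z₄ :: t =>
      have h := ih (m + 1) (by omega) (l := z₃ :: z₄ :: t)
        (fun u hu v hv => hf u (by simp_all) v (by simp_all))
      simp only [List.map_cons] at h ⊢
      rw [starts_add_two, starts_add_two, h, hf z₁ (by simp) z₃ (by simp),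
        hf z₄ (by simp) z₂ (by simp)]
    | m + 2, [] => simp
    | m + 2, [_] => simp [Starts]
    | m + 2, [_, _] => simp [Starts]
    | m + 2, [_, _, _] => simp [Starts]

/-! ### Avoidance weight, chains of clusters, and their inversion -/

open Classical in
/-- `y ^ (1 + des)` for the words without match of `tau a`, and `0` for the others. -/
noncomputable def avoidWeight (a : ℕ) : List ℕ → Ry
  | [] => 1
  | [_] => y
  | z₁ :: z₂ :: t =>
    if Starts a (z₁ :: z₂ :: t) then 0 else (if z₁ < z₂ then 1 else y) * avoidWeight a (z₂ :: t)

/-- The signed number of ways to cover the pattern `tau (k + 1)` by overlapping copies of `tau a`,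
with `1` at `k = 0`. -/
noncomputable def coverSign (a k : ℕ) : Ry := (if a ∣ k then 1 else 0) - (if a ∣ k + 1 then 1 else 0)

open Classical in
/-- The weight of the chains of ascents and clusters of copies of `tau a` on a word. -/
noncomputable def chainWeight (a : ℕ) : List ℕ → Ry
  | [] => 0
  | z :: t =>
    (if t = [] then 1 else 0) - y * (if Starts 1 (z :: t) then chainWeight a t else 0) +
      ∑ k ∈ range t.length, coverSign a k * y ^ k *
        (if Starts (k + 1) (z :: t) then chainWeight a (t.drop (2 * k)) else 0)
termination_by l => l.length
decreasing_by
  · simp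
  · simp only [List.length_drop, List.length_cons]; omega

theorem chainWeight_nil (a : ℕ) : chainWeight a [] = 0 := by rw [chainWeight]

-- The freedom in `N` lets all prefixes of a word share one range of summation: a copy of `tau (k +
-- 1)` needs 2k + 2 letters, so the extra terms vanish.
open Classical in
theorem chainWeight_cons (a z : ℕ) (t : List ℕ) {N : ℕ} (hN : t.length ≤ N) :
    chainWeight a (z :: t) =
      (if t = [] then 1 else 0) - y * (if Starts 1 (z :: t) then chainWeight a t else 0) +
      ∑ k ∈ range N, coverSign a k * y ^ k *
        (if Starts (k + 1) (z :: t) then chainWeight a (t.drop (2 * k)) else 0) := by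
  rw [chainWeight]
  congr 1
  refine sum_subset (range_mono hN) fun k _ hk => ?_
  rw [if_neg, mul_zero]
  intro h
  have := h.two_mul_le_length
  rw [List.length_cons] at this
  rw [mem_range] at hk
  omega

/-- The first letter of each piece is its smallest, and its last letter is the head of the remaining
chain, which is minimal there by induction. -/
theorem head_le_of_chainWeight_ne_zero {a z : ℕ} {t : List ℕ} (h : chainWeight a (z :: t) ≠ 0) :
    ∀ u ∈ t, z < u := by
  classical
  induction hn : t.length using Nat.strong_induction_on generalizing z t with
  | _ n ih =>
    subst hn
    have key : ∀ k, Starts (k + 1) (z :: t) → chainWeight a (t.drop (2 * k)) ≠ 0 →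
        ∀ u ∈ t, z < u := by
      intro k hk hne u hu
      have hlen := hk.two_mul_le_length
      rw [List.length_cons] at hlen
      have h1 := hk.lt_of_mem
      rw [← List.take_append_drop (2 * k + 1) t, List.mem_append] at hu
      rcases hu with hu | hu
      · exact h1 u hu
      · have hlt : 2 * k < t.length := by omega
        rw [List.drop_eq_getElem_cons hlt] at hne
        have h2 := ih (t.drop (2 * k + 1)).length (by simp; omega) hne rfl u hu
        refine lt_trans (h1 _ ?_) h2
        rw [List.mem_take_iff_getElem]
        exact ⟨2 * k, by omega, rfl⟩
    rcases eq_or_ne t [] with rfl | ht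
    · simp
    by_contra hcon
    have h0 : ∀ k, (if Starts (k + 1) (z :: t) then chainWeight a (t.drop (2 * k)) else 0) = 0 := by
      intro k
      split_ifs with hk
      · by_contra hne
        exact hcon (key k hk hne)
      · rfl
    apply h
    have h1 := h0 0
    rw [Nat.mul_zero, List.drop_zero, zero_add] at h1
    rw [chainWeight_cons a z t le_rfl, if_neg ht, h1]
    simp only [h0, mul_zero, sum_const_zero, sub_zero, add_zero]

-- Prefixes too short to reach the last letter of the pattern contribute nothing, because the empty
-- chain has weight 0; the longer prefixes are exactly the cuts of the remaining word.
open Classical in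
theorem sum_chainWeight_mul (a z k : ℕ) (t : List ℕ) (v : List ℕ → Ry) :
    ∑ i ∈ range (t.length + 1), (if Starts (k + 1) (z :: t.take i) then
        chainWeight a ((t.take i).drop (2 * k)) else 0) * v (t.drop i) =
      if Starts (k + 1) (z :: t) then conv (chainWeight a) v (t.drop (2 * k)) else 0 := by
  have h1 : ∀ i, (if Starts (k + 1) (z :: t.take i) then
        chainWeight a ((t.take i).drop (2 * k)) else 0) * v (t.drop i) =
      if Starts (k + 1) (z :: t) then
        chainWeight a ((t.take i).drop (2 * k)) * v (t.drop i) else 0 := by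
    intro i
    rcases le_or_gt (2 * k + 1) i with hi | hi
    · have h2 : Starts (k + 1) (z :: t.take i) ↔ Starts (k + 1) (z :: t) := by
        rw [← starts_take_iff (i := i + 1) (l := z :: t) (by omega), List.take_succ_cons]
      simp only [h2, ite_mul, zero_mul]
    · have h2 : (t.take i).drop (2 * k) = [] := by
        rw [List.drop_eq_nil_iff, List.length_take]
        omega
      simp only [h2, chainWeight_nil, ite_self, zero_mul]
  simp only [h1]
  split_ifs with hs
  · have hlen := hs.two_mul_le_length
    rw [List.length_cons] at hlen
    rw [conv, List.length_drop, show t.length + 1 = 2 * k + (t.length - 2 * k + 1) by omega,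
      sum_range_add, sum_eq_zero, zero_add]
    · refine sum_congr rfl fun i _ => ?_
      rw [List.drop_take, List.drop_drop, Nat.add_sub_cancel_left]
    · intro i hi
      rw [mem_range] at hi
      rw [List.drop_eq_nil_iff.2, chainWeight_nil, zero_mul]
      rw [List.length_take]
      omega
  · simp

open Classical in
theorem conv_chainWeight_cons (a z : ℕ) (t : List ℕ) (v : List ℕ → Ry) :
    conv (chainWeight a) v (z :: t) =
      v t - y * (if Starts 1 (z :: t) then conv (chainWeight a) v t else 0) +
      ∑ k ∈ range t.length, coverSign a k * y ^ k *
        (if Starts (k + 1) (z :: t) then conv (chainWeight a) v (t.drop (2 * k)) else 0) := by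
  rw [conv, List.length_cons, sum_range_succ', List.take_zero, chainWeight_nil, zero_mul, add_zero]
  simp only [List.take_succ_cons, List.drop_succ_cons]
  have h1 : ∀ i, chainWeight a (z :: t.take i) * v (t.drop i) =
      (if t.take i = [] then 1 else 0) * v (t.drop i) -
      y * ((if Starts (0 + 1) (z :: t.take i) then
        chainWeight a ((t.take i).drop (2 * 0)) else 0) * v (t.drop i)) +
      ∑ k ∈ range t.length, coverSign a k * y ^ k * ((if Starts (k + 1) (z :: t.take i) then
        chainWeight a ((t.take i).drop (2 * k)) else 0) * v (t.drop i)) := by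
    intro i
    rw [chainWeight_cons a z (t.take i) (N := t.length) (by simp), add_mul, sub_mul, sum_mul]
    simp only [mul_assoc, zero_add, mul_zero, List.drop_zero]
  simp only [h1]
  rw [sum_add_distrib, sum_sub_distrib, ← mul_sum, sum_chainWeight_mul, sum_comm]
  simp only [← mul_sum, sum_chainWeight_mul, zero_add, mul_zero, List.drop_zero]
  congr 2
  rw [sum_range_succ', List.take_zero, if_pos rfl, one_mul, List.drop_zero, sum_eq_zero, zero_add]
  intro i hi
  rw [mem_range] at hi
  rw [if_neg, zero_mul]
  rw [List.take_eq_nil_iff]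
  rintro (h | h)
  · omega
  · simp [h] at hi

theorem exists_starts_iff (l : List ℕ) : ∃ M, ∀ m, Starts m l ↔ m ≤ M := by
  classical
  refine ⟨Nat.findGreatest (fun m => Starts m l) l.length, fun m => ⟨fun h => ?_, fun h => ?_⟩⟩
  · exact Nat.le_findGreatest (by have := h.two_mul_le_length; omega) h
  · exact (Nat.findGreatest_spec (P := fun m => Starts m l) (Nat.zero_le _) (starts_zero l)).mono h

theorem avoidWeight_of_descent {a u v : ℕ} {s : List ℕ} (ha : 1 ≤ a) (h : ¬ u < v) :
    avoidWeight a (u :: v :: s) = y * avoidWeight a (v :: s) := by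
  rw [avoidWeight, if_neg, if_neg h]
  intro h'
  exact h (starts_one.1 (h'.mono ha))

open Classical in
theorem avoidWeight_of_ascent {a u v : ℕ} {s : List ℕ} (h : u < v) :
    avoidWeight a (u :: v :: s) =
      if Starts a (u :: v :: s) then 0 else avoidWeight a (v :: s) := by
  rw [avoidWeight, if_pos h, one_mul]

/-- Within the maximal pattern `tau M` descents and ascents alternate. Each descent gives a factor
y, and `tau a` starts at an ascent in position 2(k+1) exactly if k + 1 + a ≤ M: by `Starts.glue` a
copy reaching further would contradict the maximality of M. -/
theorem avoidWeight_drop {a M : ℕ} (ha : 1 ≤ a) {l : List ℕ} (hM : ∀ m, Starts m l ↔ m ≤ M)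
    {k : ℕ} (hk : k < M) : avoidWeight a (l.drop (2 * k + 1)) =
      if k + 1 + a ≤ M then 0 else
        y ^ (M - 1 - k) * avoidWeight a (l.drop (2 * (M - 1) + 1)) := by
  have hl := ((hM M).2 le_rfl).two_mul_le_length
  induction hd : M - 1 - k generalizing k with
  | zero =>
    rw [if_neg (by omega), show M - 1 = k by omega, pow_zero, one_mul]
  | succ d ih =>
    have h1 := ih (k := k + 1) (by omega) (by omega)
    have hodd := ((hM M).2 le_rfl).not_starts_odd (j := k) (by omega)
    have heven := (((hM M).2 le_rfl).drop (j := k + 1)).mono (m' := 1) (by omega)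
    have hiff : Starts a (l.drop (2 * (k + 1))) ↔ k + 1 + a ≤ M := by
      constructor
      · intro h
        exact (hM _).1 (((hM M).2 le_rfl).glue (by omega) h)
      · intro h
        have := ((hM _).2 h).drop (j := k + 1)
        rwa [Nat.add_sub_cancel_left] at this
    rw [List.drop_eq_getElem_cons (by omega), List.drop_eq_getElem_cons (by omega)] at hodd ⊢
    rw [avoidWeight_of_descent ha (fun h => hodd (starts_one.2 h))]
    rw [show 2 * (k + 1) = 2 * k + 1 + 1 by ring] at hiff h1 heven
    rw [List.drop_eq_getElem_cons (by omega), List.drop_eq_getElem_cons (by omega)] at heven hiff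
    rw [List.drop_eq_getElem_cons (i := 2 * k + 1 + 1 + 1) (by omega),
      avoidWeight_of_ascent (starts_one.1 heven)]
    rw [List.drop_eq_getElem_cons (i := 2 * k + 1 + 1 + 1) (by omega)] at h1
    rw [h1]
    by_cases h2 : k + 1 + a ≤ M
    · rw [if_pos (hiff.2 h2), if_pos h2, mul_zero]
    · rw [if_neg (fun h => h2 (hiff.1 h)), if_neg h2, if_neg (by omega), pow_succ', mul_assoc]

/-- Telescoping leaves [a ∣ M - a] - [a ∣ M]. For a ≤ M these agree; for M < a the truncated
difference is 0, so the first bracket is 1 and the second 0. -/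
theorem sum_coverSign {a M : ℕ} (hM : 0 < M) :
    ∑ k ∈ Ico (M - a) M, coverSign a k = if a ≤ M then 0 else 1 := by
  have h : ∀ n, ∑ k ∈ range n, coverSign a k = 1 - if a ∣ n then 1 else 0 := by
    intro n
    simp only [coverSign]
    rw [sum_range_sub']
    simp
  rw [sum_Ico_eq_sub _ (Nat.sub_le M a), h, h]
  by_cases h1 : a ≤ M
  · rw [if_pos h1]
    simp only [Nat.dvd_sub_iff_left h1 dvd_rfl, sub_self]
  · rw [if_neg h1, Nat.sub_eq_zero_of_le (by omega), if_pos (dvd_zero a),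
      if_neg (Nat.not_dvd_of_pos_of_lt hM (by omega))]
    ring

/-- Peel off the first piece of the chain and apply induction to what remains. At an initial ascent
all surviving terms carry the same factor y^(M-1) A(rest), with M the maximal m such that `tau m`
starts the word; their signs add up to 1 if M < a and to 0 if `tau a` starts the word. -/
theorem y_mul_conv {a : ℕ} (ha : 1 ≤ a) {l : List ℕ} (hl : l ≠ []) :
    y * conv (chainWeight a) (avoidWeight a) l = avoidWeight a l := by
  classical
  induction hn : l.length using Nat.strong_induction_on generalizing l with
  | _ n ih =>
    subst hn
    match l, hl with
    | [z], _ =>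
      rw [conv_chainWeight_cons]
      simp [avoidWeight, Starts]
    | z₁ :: z₂ :: s, _ =>
      rw [conv_chainWeight_cons]
      set t := z₂ :: s with ht
      have h1 : ∀ k, y * (if Starts (k + 1) (z₁ :: t) then
          conv (chainWeight a) (avoidWeight a) (t.drop (2 * k)) else 0) =
          if Starts (k + 1) (z₁ :: t) then avoidWeight a (t.drop (2 * k)) else 0 := by
        intro k
        split_ifs with h
        · have hlen := h.two_mul_le_length
          rw [List.length_cons] at hlen
          refine ih _ ?_ ?_ rfl
          · simp only [List.length_drop, List.length_cons]; omega
          · rw [Ne, List.drop_eq_nil_iff]; omega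
        · rw [mul_zero]
      have h10 := h1 0
      simp only [zero_add, mul_zero, List.drop_zero] at h10
      have h2 : y * (avoidWeight a t - y * (if Starts 1 (z₁ :: t) then
            conv (chainWeight a) (avoidWeight a) t else 0) +
          ∑ k ∈ range t.length, coverSign a k * y ^ k * (if Starts (k + 1) (z₁ :: t) then
            conv (chainWeight a) (avoidWeight a) (t.drop (2 * k)) else 0)) =
          y * avoidWeight a t - y * (if Starts 1 (z₁ :: t) then avoidWeight a t else 0) +
          ∑ k ∈ range t.length, coverSign a k * y ^ k * (if Starts (k + 1) (z₁ :: t) then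
            avoidWeight a (t.drop (2 * k)) else 0) := by
        rw [mul_add, mul_sub, h10, mul_sum]
        congr 1
        refine sum_congr rfl fun k _ => ?_
        rw [← h1 k]
        ring
      rw [h2]
      obtain ⟨M, hM⟩ := exists_starts_iff (z₁ :: t)
      have hlen := ((hM M).2 le_rfl).two_mul_le_length
      rw [List.length_cons] at hlen
      by_cases hz : z₁ < z₂
      · have hM1 : 1 ≤ M := (hM 1).1 (starts_one.2 hz)
        have hg := fun k (hk : k < M) => avoidWeight_drop ha hM hk
        simp only [List.drop_succ_cons] at hg
        have hg0 := hg 0 hM1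
        rw [mul_zero, List.drop_zero] at hg0
        -- At an ascent the chain step of weight -y cancels the term where the chain is a single
        -- letter.
        rw [if_pos (starts_one.2 hz), sub_self, zero_add, avoidWeight_of_ascent hz]
        have h3 : ∑ k ∈ range t.length, coverSign a k * y ^ k * (if Starts (k + 1) (z₁ :: t) then
            avoidWeight a (t.drop (2 * k)) else 0) =
            ∑ k ∈ Ico (M - a) M, coverSign a k *
              (y ^ (M - 1) * avoidWeight a (t.drop (2 * (M - 1)))) := by
          symm
          refine sum_subset_zero_on_sdiff (fun k hk => ?_) ?_ ?_
          · rw [mem_Ico] at hk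
            rw [mem_range]
            omega
          · intro k hk
            rw [mem_sdiff, mem_Ico] at hk
            simp only [hM]
            split_ifs with hkM
            · rw [hg k (by omega), if_pos (by omega), mul_zero]
            · rw [mul_zero]
          · intro k hk
            rw [mem_Ico] at hk
            simp only [hM]
            rw [if_pos (by omega), hg k hk.2, if_neg (by omega), mul_assoc, ← mul_assoc (y ^ k),
              ← pow_add, show k + (M - 1 - k) = M - 1 by omega]
        rw [h3, ← sum_mul, sum_coverSign hM1, ← ht]
        simp only [hM]
        split_ifs with haM
        · rw [zero_mul]
        · rw [hg0, if_neg (by omega), one_mul, Nat.sub_zero]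
      · have h0 : ∀ k, ¬ Starts (k + 1) (z₁ :: t) := fun k h =>
          hz (starts_one.1 (h.mono (by omega)))
        rw [avoidWeight_of_descent ha hz, if_neg (h0 0)]
        simp only [if_neg (h0 _)]
        simp [ht]

theorem orderInvariant_avoidWeight (a : ℕ) : OrderInvariant (avoidWeight a) := by
  intro l f
  induction l with
  | nil => simp
  | cons z₁ t ih =>
    intro hf
    cases t with
    | nil => simp [avoidWeight]
    | cons z₂ t =>
      have h1 := ih fun u hu v hv => hf u (List.mem_cons_of_mem _ hu) v (List.mem_cons_of_mem _ hv)
      have h2 := starts_map hf a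
      have h3 := hf z₁ (by simp) z₂ (by simp)
      simp only [List.map_cons] at h1 h2 ⊢
      rw [avoidWeight, avoidWeight, h1]
      by_cases hs : Starts a (z₁ :: z₂ :: t)
      · rw [if_pos (h2.2 hs), if_pos hs]
      · rw [if_neg (fun h => hs (h2.1 h)), if_neg hs]
        simp only [h3]

theorem orderInvariant_chainWeight (a : ℕ) : OrderInvariant (chainWeight a) := by
  classical
  intro l f hf
  induction hn : l.length using Nat.strong_induction_on generalizing l with
  | _ n ih =>
    subst hn
    cases l with
    | nil => simp
    | cons z t =>
      have h1 : ∀ k, chainWeight a ((t.map f).drop k) = chainWeight a (t.drop k) := by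
        intro k
        rw [← List.map_drop]
        refine ih _ ?_ _ ?_ rfl
        · simp only [List.length_drop, List.length_cons]; omega
        · intro u hu v hv
          exact hf u (List.mem_cons_of_mem _ (List.mem_of_mem_drop hu)) v
            (List.mem_cons_of_mem _ (List.mem_of_mem_drop hv))
      have h2 := starts_map hf
      have h10 := h1 0
      rw [List.drop_zero, List.drop_zero] at h10
      rw [List.map_cons] at h2 ⊢
      rw [chainWeight, chainWeight, List.length_map]
      simp only [h1, h2, h10, List.map_eq_nil_iff]

/-! ### Counting the words that start with a pattern -/

theorem wordSum_eq_of_head_min {R : Type*} [CommRing R] {w : List ℕ → R} {S : Finset ℕ}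
    (hS : S.Nonempty) (hw : ∀ z t, w (z :: t) ≠ 0 → ∀ u ∈ t, z < u) :
    wordSum w S = wordSum (fun l => w (S.min' hS :: l)) (S.erase (S.min' hS)) := by
  rw [wordSum_cons w hS]
  refine sum_eq_single (S.min' hS) (fun z hz hne => ?_) (fun h => absurd (S.min'_mem hS) h)
  refine sum_eq_zero fun l hl => ?_
  by_contra h
  have h1 := hw z l h (S.min' hS)
    ((mem_of_mem_words hl).2 (mem_erase.2 ⟨hne.symm, S.min'_mem hS⟩))
  exact absurd (S.min'_le z hz) (by omega)

-- A word of nonzero weight begins with the minimum of `S`, so the condition on its head concerns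
-- `S` alone and factors out.
open Classical in
theorem wordSum_head_lt {R : Type*} [CommRing R] {w : List ℕ → R} {S : Finset ℕ}
    (hw : ∀ z t, w (z :: t) ≠ 0 → ∀ u ∈ t, z < u) (hw0 : w [] = 0) (b : ℕ) :
    wordSum (fun l => if ∃ z t, l = z :: t ∧ z < b then w l else 0) S =
      if ∃ s ∈ S, s < b then wordSum w S else 0 := by
  classical
  split_ifs with hb
  · refine wordSum_congr fun l hl => ?_
    by_cases h : w l = 0
    · rw [h, ite_self]
    · cases l with
      | nil => exact absurd hw0 h
      | cons z t =>
        rw [if_pos]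
        obtain ⟨s, hs, hsb⟩ := hb
        rw [← mem_of_mem_words hl, List.mem_cons] at hs
        rcases hs with rfl | hs
        · exact ⟨_, _, rfl, hsb⟩
        · exact ⟨_, _, rfl, (hw z t h s hs).trans hsb⟩
  · refine sum_eq_zero fun l hl => if_neg ?_
    rintro ⟨z, t, rfl, hz⟩
    exact hb ⟨z, (mem_of_mem_words hl).1 (by simp), hz⟩

open Classical in
/-- The weight of a word that starts with the pattern `tau (k + 1)`, with a second letter below
`b`, and continues, from the last letter of the pattern on, with the weight `w`. -/
noncomputable def startWeight {R : Type*} [CommRing R] (w : List ℕ → R) (k b : ℕ)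
    (l : List ℕ) : R :=
  if Starts (k + 1) l ∧ l.getD 1 0 < b then w (l.drop (2 * k + 1)) else 0

section count

variable {R : Type*} [CommRing R] {w : List ℕ → R}

theorem head_le_of_startWeight_ne_zero (hw : ∀ z t, w (z :: t) ≠ 0 → ∀ u ∈ t, z < u)
    (k b z : ℕ) (t : List ℕ) (h : startWeight w k b (z :: t) ≠ 0) :
    ∀ u ∈ t, z < u := by
  classical
  rw [startWeight] at h
  split_ifs at h with hs
  · have h1 := hs.1.lt_of_mem
    have hlen := hs.1.two_mul_le_length
    rw [List.length_cons] at hlen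
    rw [List.drop_succ_cons, List.drop_eq_getElem_cons (by omega)] at h
    intro u hu
    rw [← List.take_append_drop (2 * k + 1) t, List.mem_append] at hu
    rcases hu with hu | hu
    · exact h1 u hu
    · refine lt_trans (h1 _ ?_) (hw _ _ h u hu)
      rw [List.mem_take_iff_getElem]
      exact ⟨2 * k, by omega, rfl⟩
  · exact absurd rfl h

/-- After the removal of the first pair its only trace is that the next second letter must lie below
z₂; this is why `startWeight` carries a bound. -/
theorem startWeight_cons_cons {k b z₁ z₂ : ℕ} {t : List ℕ} (hz : ∀ u ∈ t, z₁ < u) :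
    startWeight w (k + 1) b (z₁ :: z₂ :: t) = if z₂ < b then startWeight w k z₂ t else 0 := by
  classical
  have h : Starts (k + 2) (z₁ :: z₂ :: t) ↔ Starts (k + 1) t ∧ t.getD 1 0 < z₂ := by
    constructor
    · intro h
      obtain ⟨_, _, _, _, _, he, h1, h2, h3⟩ := starts_add_two_iff.1 h
      simp only [List.cons.injEq] at he
      obtain ⟨rfl, rfl, rfl⟩ := he
      exact ⟨h3, by simpa using h2⟩
    · rintro ⟨h1, h2⟩
      have hlen := h1.two_mul_le_length
      match t, hlen with
      | z₃ :: z₄ :: t, _ =>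
        exact starts_add_two.2 ⟨hz _ (by simp), by simpa using h2, h1⟩
  rw [startWeight, startWeight, h]
  simp only [List.getD_cons_succ, List.getD_cons_zero,
    show 2 * (k + 1) + 1 = 2 * k + 1 + 2 by ring, List.drop_succ_cons]
  split_ifs <;> first | rfl | (exfalso; tauto)

/-- A hockey-stick identity. The guards matter for k = 0, where the binomial coefficient is 1 even
if there are too few letters. -/
theorem sum_range_choose_shift (r k : ℕ) :
    (∑ j ∈ range r, if 2 * k + 3 ≤ j + 1 then (j + 1 - k - 3).choose k else 0) =
      if 2 * k + 4 ≤ r + 1 then (r + 1 - k - 3).choose (k + 1) else 0 := by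
  induction r with
  | zero => simp
  | succ r ih =>
    rw [sum_range_succ, ih]
    rcases lt_trichotomy (2 * k + 2) r with h | h | h
    · rw [if_pos (by omega), if_pos (by omega), if_pos (by omega),
        show r + 1 + 1 - k - 3 = (r + 1 - k - 3) + 1 by omega, Nat.choose_succ_succ, add_comm]
    · rw [if_neg (by omega), if_pos (by omega), if_pos (by omega), ← h,
        show 2 * k + 2 + 1 - k - 3 = k by omega, show 2 * k + 2 + 1 + 1 - k - 3 = k + 1 by omega,
        Nat.choose_self, Nat.choose_self]
    · rw [if_neg (by omega), if_neg (by omega), if_neg (by omega)]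

/-- The first letter is forced to be the minimum. Summing over the second letter, which becomes the
bound for the rest, reduces k by one and adds up binomial coefficients. -/
theorem wordSum_startWeight (hi : OrderInvariant w)
    (hw : ∀ z t, w (z :: t) ≠ 0 → ∀ u ∈ t, z < u) (hw0 : w [] = 0) (k b : ℕ) (S : Finset ℕ) :
    wordSum (startWeight w k b) S =
      (if 2 * k + 2 ≤ #{s ∈ S | s < b} then (#{s ∈ S | s < b} - k - 2).choose k else 0 : ℕ) *
        wordSum w (range (#S - 2 * k - 1)) := by
  classical
  induction k generalizing b S with
  | zero =>
    rcases S.eq_empty_or_nonempty with rfl | hS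
    · simp [wordSum, words_empty, startWeight, Starts]
    rw [wordSum_eq_of_head_min hS (head_le_of_startWeight_ne_zero hw 0 b)]
    set m := S.min' hS with hm
    have hmS : m ∈ S := S.min'_mem hS
    have h1 : ∀ l ∈ words (S.erase m), startWeight w 0 b (m :: l) =
        if ∃ z t, l = z :: t ∧ z < b then w l else 0 := by
      intro l hl
      rw [startWeight]
      cases l with
      | nil => simp [Starts]
      | cons z t =>
        have hz := (mem_of_mem_words hl (z := z)).1 (by simp)
        have hmz : m < z := S.min'_lt_of_mem_erase_min' hS hz
        simp [starts_one, hmz]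
    rw [wordSum_congr h1, wordSum_head_lt hw hw0, hi.wordSum_eq, card_erase_of_mem hmS]
    have h2 : (∃ s ∈ S.erase m, s < b) ↔ 2 * 0 + 2 ≤ #{s ∈ S | s < b} := by
      rw [show (2 * 0 + 2 ≤ #{s ∈ S | s < b}) ↔ 1 < #{s ∈ S | s < b} from Iff.rfl, one_lt_card]
      constructor
      · rintro ⟨s, hs, hsb⟩
        have hms : m < s := S.min'_lt_of_mem_erase_min' hS hs
        exact ⟨m, mem_filter.2 ⟨hmS, hms.trans hsb⟩, s,
          mem_filter.2 ⟨mem_of_mem_erase hs, hsb⟩, hms.ne⟩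
      · rintro ⟨u, hu, v, hv, huv⟩
        rw [mem_filter] at hu hv
        by_cases hum : u = m
        · exact ⟨v, mem_erase.2 ⟨fun h => huv (hum.trans h.symm), hv.1⟩, hv.2⟩
        · exact ⟨u, mem_erase.2 ⟨hum, hu.1⟩, hu.2⟩
    simp only [h2]
    split_ifs <;> simp
  | succ k ih =>
    rcases S.eq_empty_or_nonempty with rfl | hS
    · simp [wordSum, words_empty, startWeight, Starts]
    rw [wordSum_eq_of_head_min hS (head_le_of_startWeight_ne_zero hw (k + 1) b)]
    set m := S.min' hS with hm
    have hmS : m ∈ S := S.min'_mem hS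
    have hlt : ∀ z ∈ S.erase m, m < z := fun z hz => S.min'_lt_of_mem_erase_min' hS hz
    set S' := S.erase m with hS'
    have hcard : #S' = #S - 1 := card_erase_of_mem hmS
    rcases S'.eq_empty_or_nonempty with h0 | hS'n
    · have h1 : #{s ∈ S | s < b} ≤ 1 := by
        refine (card_filter_le _ _).trans ?_
        rw [h0, card_empty] at hcard
        omega
      rw [h0, if_neg (by omega)]
      simp [wordSum, words_empty, startWeight, Starts]
    rw [wordSum_cons _ hS'n]
    have h1 : ∀ z ∈ S', wordSum (fun l => startWeight w (k + 1) b (m :: z :: l)) (S'.erase z) =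
        if z < b then
          ((if 2 * k + 3 ≤ #{s ∈ {s ∈ S' | s < b} | s < z} + 1 then
            (#{s ∈ {s ∈ S' | s < b} | s < z} + 1 - k - 3).choose k else 0 : ℕ) : R) *
          wordSum w (range (#S - 2 * (k + 1) - 1)) else 0 := by
      intro z hz
      have h2 : ∀ l ∈ words (S'.erase z), startWeight w (k + 1) b (m :: z :: l) =
          if z < b then startWeight w k z l else 0 := fun l hl =>
        startWeight_cons_cons fun u hu =>
          hlt u (mem_of_mem_erase ((mem_of_mem_words hl).1 hu))
      rw [wordSum_congr h2]
      by_cases hzb : z < b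
      · simp only [if_pos hzb]
        have h3 : {s ∈ S'.erase z | s < z} = {s ∈ {s ∈ S' | s < b} | s < z} := by
          ext s
          simp only [mem_filter, mem_erase]
          constructor
          · rintro ⟨⟨-, h4⟩, h5⟩
            exact ⟨⟨h4, h5.trans hzb⟩, h5⟩
          · rintro ⟨⟨h4, -⟩, h5⟩
            exact ⟨⟨h5.ne, h4⟩, h5⟩
        have h4 := ih z (S'.erase z)
        rw [h3, card_erase_of_mem hz, hcard] at h4
        rw [show (fun l => startWeight w k z l) = startWeight w k z from rfl, h4]
        have h5 : ∀ j, j + 1 - k - 3 = j - k - 2 := fun j => by omega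
        simp only [show 2 * k + 3 = 2 * k + 2 + 1 by ring, Nat.add_le_add_iff_right, h5,
          show #S - 1 - 1 - 2 * k - 1 = #S - 2 * (k + 1) - 1 by omega]
      · simp only [if_neg hzb]
        simp [wordSum]
    rw [sum_congr rfl h1, ← sum_filter, ← sum_mul]
    congr 1
    -- The summand depends on the second letter only through its rank among the non-minimal letters
    -- below b.
    rw [← Nat.cast_sum, sum_rank (fun j => if 2 * k + 3 ≤ j + 1 then (j + 1 - k - 3).choose k else 0),
      sum_range_choose_shift]
    congr 1
    have h2 : #{s ∈ S' | s < b} = #{s ∈ S | s < b} - 1 := by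
      rw [hS', filter_erase]
      by_cases hmb : m < b
      · rw [card_erase_of_mem (mem_filter.2 ⟨hmS, hmb⟩)]
      · have : {s ∈ S | s < b} = ∅ := filter_eq_empty_iff.2 fun s hs hsb =>
          hmb (lt_of_le_of_lt (S.min'_le s hs) hsb)
        simp [this]
    rw [h2]
    by_cases h3 : 2 * (k + 1) + 2 ≤ #{s ∈ S | s < b}
    · rw [if_pos h3, if_pos (by omega)]
      congr 1
      omega
    · rw [if_neg h3, if_neg (by omega)]

end count

theorem wordSum_range_zero {R : Type*} [CommRing R] (w : List ℕ → R) :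
    wordSum w (range 0) = w [] := by
  rw [wordSum, range_zero, words_empty, sum_singleton]

theorem wordSum_range_one {R : Type*} [CommRing R] (w : List ℕ → R) :
    wordSum w (range 1) = w [0] := by
  rw [wordSum_cons w (by simp), sum_range_one, wordSum, show (range 1).erase 0 = ∅ by decide,
    words_empty, sum_singleton]

/-- The bound n exceeds every letter and is vacuous here; n ≥ 2 removes the one-letter term of the
recursion. -/
theorem chainWeight_eq_sum_startWeight (a : ℕ) {n : ℕ} (hn : 2 ≤ n) {l : List ℕ}
    (hl : l ∈ words (range n)) : chainWeight a l = -y * startWeight (chainWeight a) 0 n l +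
      ∑ k ∈ range n, coverSign a k * y ^ k * startWeight (chainWeight a) k n l := by
  classical
  have hlen := length_of_mem_words hl
  rw [card_range] at hlen
  cases l with
  | nil => rw [List.length_nil] at hlen; omega
  | cons z₁ t =>
    cases t with
    | nil => rw [List.length_singleton] at hlen; omega
    | cons z₂ t =>
      have hz : z₂ < n := mem_range.1 ((mem_of_mem_words hl).1 (by simp))
      have h : ∀ k, startWeight (chainWeight a) k n (z₁ :: z₂ :: t) =
          if Starts (k + 1) (z₁ :: z₂ :: t) then
            chainWeight a ((z₂ :: t).drop (2 * k)) else 0 := by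
        intro k
        rw [startWeight, List.drop_succ_cons]
        simp only [List.getD_cons_succ, List.getD_cons_zero, hz, and_true]
      have h0 := h 0
      rw [Nat.mul_zero, List.drop_zero, zero_add] at h0
      rw [chainWeight_cons a z₁ (z₂ :: t) (N := n) (by rw [← hlen]; simp), h0,
        if_neg (List.cons_ne_nil _ _), zero_sub, neg_mul]
      simp only [h]

theorem chainSum_eq (a : ℕ) {n : ℕ} (hn : 2 ≤ n) :
    wordSum (chainWeight a) (range n) = -y * wordSum (chainWeight a) (range (n - 1)) +
      ∑ k ∈ range (n / 2), coverSign a k * (y ^ k * ((n - k - 2).choose k : Ry) *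
        wordSum (chainWeight a) (range (n - 2 * k - 1))) := by
  classical
  have hcount : ∀ k, wordSum (startWeight (chainWeight a) k n) (range n) =
      ((if 2 * k + 2 ≤ n then (n - k - 2).choose k else 0 : ℕ) : Ry) *
        wordSum (chainWeight a) (range (n - 2 * k - 1)) := by
    intro k
    have h := wordSum_startWeight (orderInvariant_chainWeight a)
      (fun z t h => head_le_of_chainWeight_ne_zero h) (chainWeight_nil a) k n (range n)
    rwa [filter_true_of_mem (fun s hs => mem_range.1 hs), card_range] at h
  have h1 := fun l hl => chainWeight_eq_sum_startWeight a hn (l := l) hl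
  rw [wordSum_congr h1, wordSum, sum_add_distrib, ← mul_sum, sum_comm]
  simp only [← mul_sum]
  have h2 : ∀ k, ∑ l ∈ words (range n), startWeight (chainWeight a) k n l =
      wordSum (startWeight (chainWeight a) k n) (range n) := fun k => rfl
  simp only [h2, hcount]
  refine congrArg₂ (· + ·) ?_ ?_
  · rw [if_pos (by omega)]
    simp
  · symm
    refine sum_subset_zero_on_sdiff (fun k hk => ?_) (fun k hk => ?_) (fun k hk => ?_)
    · rw [mem_range] at hk ⊢
      omega
    · rw [mem_sdiff, mem_range, mem_range] at hk
      rw [if_neg (by omega), Nat.cast_zero, zero_mul, mul_zero]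
    · rw [mem_range] at hk
      rw [if_pos (by omega)]
      ring

/-! ### The recursion for the reciprocal series -/

theorem sum_ite_dvd_succ {M : Type*} [AddCommMonoid M] (a N : ℕ) (F : ℕ → M) :
    (∑ k ∈ range N, if a ∣ k + 1 then F k else 0) =
      ∑ j ∈ range (N / a), F ((j + 1) * a - 1) := by
  induction N with
  | zero => simp
  | succ N ih =>
    rw [sum_range_succ, ih, Nat.succ_div]
    split_ifs with h
    · rw [sum_range_succ]
      congr 2
      have h1 : (N + 1) / a = N / a + 1 := by rw [Nat.succ_div, if_pos h]
      rw [← h1, Nat.div_mul_cancel h]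
      omega
    · rw [add_zero, add_zero]

theorem sum_coverSign_mul {a N : ℕ} (hN : 1 ≤ N) (F : ℕ → Ry) :
    ∑ k ∈ range N, coverSign a k * F k = F 0 -
      ∑ j ∈ range (N / a), F ((j + 1) * a - 1) +
      ∑ j ∈ range ((N - 1) / a), F ((j + 1) * a - 1 + 1) := by
  obtain ⟨N, rfl⟩ : ∃ M, N = M + 1 := ⟨N - 1, by omega⟩
  have h1 : ∀ k, coverSign a k * F k =
      (if a ∣ k then F k else 0) - (if a ∣ k + 1 then F k else 0) := by
    intro k
    rw [coverSign, sub_mul, ite_mul, ite_mul, one_mul, zero_mul]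
  simp only [h1]
  rw [sum_sub_distrib, sum_ite_dvd_succ, sum_range_succ', sum_ite_dvd_succ a N fun k => F (k + 1),
    if_pos (dvd_zero a), Nat.add_sub_cancel]
  ring

/-- The coefficients of the reciprocal of the generating function of `avoidWeight a`. -/
noncomputable def recipSum (a n : ℕ) : Ry :=
  (if n = 0 then 1 else 0) - y * wordSum (chainWeight a) (range n)

theorem recipSum_zero (a : ℕ) : recipSum a 0 = 1 := by
  rw [recipSum, wordSum_range_zero, chainWeight_nil]
  simp

theorem recipSum_one (a : ℕ) : recipSum a 1 = -y := by
  rw [recipSum, wordSum_range_one, chainWeight_cons a 0 [] le_rfl]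
  simp [Starts]

theorem recipSum_of_pos (a : ℕ) {n : ℕ} (hn : 1 ≤ n) :
    recipSum a n = -y * wordSum (chainWeight a) (range n) := by
  rw [recipSum, if_neg (by omega)]
  ring

theorem recipSum_eq (a : ℕ) (ha : 1 ≤ a) (n : ℕ) (hn : 2 ≤ n) :
    recipSum a n = (1 - y) * recipSum a (n - 1) -
      ∑ k ∈ range (n / (2 * a)), ((n - (k + 1) * a - 1).choose ((k + 1) * a - 1) : Ry) *
        y ^ ((k + 1) * a - 1) * recipSum a (n - 2 * (k + 1) * a + 1) +
      ∑ k ∈ range ((n - 2) / (2 * a)), ((n - (k + 1) * a - 2).choose ((k + 1) * a) : Ry) *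
        y ^ ((k + 1) * a) * recipSum a (n - 2 * (k + 1) * a - 1) := by
  have h1 : recipSum a n = -y * recipSum a (n - 1) + ∑ k ∈ range (n / 2), coverSign a k *
      (((n - k - 2).choose k : Ry) * y ^ k * recipSum a (n - 2 * k - 1)) := by
    rw [recipSum_of_pos a (by omega), recipSum_of_pos a (show 1 ≤ n - 1 by omega),
      chainSum_eq a hn, mul_add, mul_sum]
    refine congrArg₂ (· + ·) rfl ?_
    refine sum_congr rfl fun k hk => ?_
    rw [mem_range] at hk
    rw [recipSum_of_pos a (by omega)]
    ring
  rw [h1, sum_coverSign_mul (by omega), Nat.div_div_eq_div_mul,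
    show (n / 2 - 1) = (n - 2) / 2 by omega, Nat.div_div_eq_div_mul]
  have h2 : ∀ j ∈ range (n / (2 * a)), 2 * ((j + 1) * a) ≤ n ∧ 1 ≤ (j + 1) * a := by
    intro j hj
    rw [mem_range] at hj
    refine ⟨?_, Nat.mul_pos (by omega) ha⟩
    calc 2 * ((j + 1) * a) = (j + 1) * (2 * a) := by ring
      _ ≤ n / (2 * a) * (2 * a) := Nat.mul_le_mul_right _ hj
      _ ≤ n := Nat.div_mul_le_self _ _
  have e1 : ∑ j ∈ range (n / (2 * a)), (((n - ((j + 1) * a - 1) - 2).choose ((j + 1) * a - 1) : Ry) *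
      y ^ ((j + 1) * a - 1) * recipSum a (n - 2 * ((j + 1) * a - 1) - 1)) =
      ∑ k ∈ range (n / (2 * a)), ((n - (k + 1) * a - 1).choose ((k + 1) * a - 1) : Ry) *
        y ^ ((k + 1) * a - 1) * recipSum a (n - 2 * (k + 1) * a + 1) := by
    refine sum_congr rfl fun j hj => ?_
    obtain ⟨h3, h4⟩ := h2 j hj
    rw [mul_assoc 2 (j + 1) a, show n - ((j + 1) * a - 1) - 2 = n - (j + 1) * a - 1 by omega,
      show n - 2 * ((j + 1) * a - 1) - 1 = n - 2 * ((j + 1) * a) + 1 by omega]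
  have e2 : ∑ j ∈ range ((n - 2) / (2 * a)), (((n - ((j + 1) * a - 1 + 1) - 2).choose
      ((j + 1) * a - 1 + 1) : Ry) * y ^ ((j + 1) * a - 1 + 1) *
      recipSum a (n - 2 * ((j + 1) * a - 1 + 1) - 1)) =
      ∑ k ∈ range ((n - 2) / (2 * a)), ((n - (k + 1) * a - 2).choose ((k + 1) * a) : Ry) *
        y ^ ((k + 1) * a) * recipSum a (n - 2 * (k + 1) * a - 1) := by
    refine sum_congr rfl fun j _ => ?_
    rw [Nat.sub_add_cancel (Nat.mul_pos (Nat.succ_pos j) ha), mul_assoc 2 (j + 1) a]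
  rw [e1, e2]
  -- The term k = 0 is `recipSum a (n - 1)`, which joins the ascents of weight -y to give 1 - y.
  simp only [Nat.sub_zero, Nat.mul_zero, Nat.choose_zero_right, Nat.cast_one, pow_zero]
  ring

theorem egf_recipSum_mul {a : ℕ} (ha : 1 ≤ a) :
    egf (recipSum a) * egf (fun n => wordSum (avoidWeight a) (range n)) = 1 := by
  rw [egf_mul_egf]
  ext1 n
  have h1 : ∑ k ∈ range (n + 1), (n.choose k : Ry) * (recipSum a k *
      wordSum (avoidWeight a) (range (n - k))) = if n = 0 then 1 else 0 := by
    have h2 : ∀ k, (n.choose k : Ry) * (recipSum a k * wordSum (avoidWeight a) (range (n - k))) =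
        (if k = 0 then (n.choose k : Ry) * wordSum (avoidWeight a) (range (n - k)) else 0) -
        y * ((n.choose k : Ry) * (wordSum (chainWeight a) (range k) *
          wordSum (avoidWeight a) (range (n - k)))) := by
      intro k
      rw [recipSum]
      split_ifs <;> ring
    simp only [h2]
    rw [sum_sub_distrib, ← mul_sum, ← wordSum_conv (orderInvariant_chainWeight a)
      (orderInvariant_avoidWeight a), sum_ite_eq' (range (n + 1)) 0, if_pos (by simp)]
    rw [Nat.choose_zero_right, Nat.cast_one, one_mul, Nat.sub_zero]
    split_ifs with hn
    · subst hn
      rw [wordSum_range_zero, wordSum_range_zero]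
      simp [conv, chainWeight_nil, avoidWeight]
    · rw [sub_eq_zero, wordSum, wordSum, mul_sum]
      refine sum_congr rfl fun l hl => (y_mul_conv ha ?_).symm
      rintro rfl
      have := length_of_mem_words hl
      simp at this
      exact hn this.symm
  rw [coeff_egf, h1, PowerSeries.coeff_one]
  split_ifs with hn
  · subst hn
    simp
  · simp

/-! ### Left-to-right minima and the power law -/

/-- The number of left-to-right minima of a word that are smaller than `b`. -/
def lrBelow : ℕ → List ℕ → ℕ
  | _, [] => 0
  | b, z :: t => if z < b then 1 + lrBelow z t else lrBelow b t

/-- The number of left-to-right minima of a word. -/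
def lrCount : List ℕ → ℕ
  | [] => 0
  | z :: t => 1 + lrBelow z t

theorem lrBelow_map {f : ℕ → ℕ} {b : ℕ} {l : List ℕ}
    (hf : ∀ u ∈ b :: l, ∀ v ∈ b :: l, u < v ↔ f u < f v) :
    lrBelow (f b) (l.map f) = lrBelow b l := by
  induction l generalizing b with
  | nil => rfl
  | cons z t ih =>
    rw [List.map_cons, lrBelow, lrBelow,
      ih fun u hu v hv => hf u (List.mem_cons_of_mem _ hu) v (List.mem_cons_of_mem _ hv),
      ih fun u hu v hv => hf u (by simp_all; tauto) v (by simp_all; tauto)]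
    simp only [hf z (by simp) b (by simp)]

theorem lrBelow_zero (l : List ℕ) : lrBelow 0 l = 0 := by
  induction l with
  | nil => rfl
  | cons z t ih => rw [lrBelow, if_neg (Nat.not_lt_zero z), ih]

theorem lrBelow_append_zero {b : ℕ} {l₁ l₂ : List ℕ} (hb : 0 < b) (h : ∀ u ∈ l₁, 0 < u) :
    lrBelow b (l₁ ++ 0 :: l₂) = lrBelow b l₁ + 1 := by
  induction l₁ generalizing b with
  | nil => simp [lrBelow, hb, lrBelow_zero]
  | cons z t ih =>
    have ht := fun u hu => h u (List.mem_cons_of_mem _ hu)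
    rw [List.cons_append, lrBelow, lrBelow, ih hb ht, ih (h z (by simp)) ht]
    split_ifs <;> omega

theorem lrCount_append_zero {l₁ l₂ : List ℕ} (h : ∀ u ∈ l₁, 0 < u) :
    lrCount (l₁ ++ 0 :: l₂) = lrCount l₁ + 1 := by
  cases l₁ with
  | nil => simp [lrCount, lrBelow_zero]
  | cons z t =>
    rw [List.cons_append, lrCount, lrCount, lrBelow_append_zero (h z (by simp))
      fun u hu => h u (List.mem_cons_of_mem _ hu)]
    ring

/-- A copy starting in l₁ and reaching m would have a first letter larger than m, yet the first
letter of a copy is its smallest. -/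
theorem starts_append_iff {a m : ℕ} (ha : 1 ≤ a) {l₁ l₂ : List ℕ} (h0 : l₁ ≠ [])
    (h : ∀ u ∈ l₁, m < u) : Starts a (l₁ ++ m :: l₂) ↔ Starts a l₁ := by
  rcases le_or_gt (2 * a) l₁.length with hl | hl
  · rw [← starts_take_iff (i := l₁.length) hl, List.take_left]
  · constructor
    · intro hs
      obtain ⟨k, rfl⟩ : ∃ k, a = k + 1 := ⟨a - 1, by omega⟩
      cases l₁ with
      | nil => exact absurd rfl h0
      | cons z t =>
        rw [List.cons_append] at hs
        rw [List.length_cons] at hl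
        refine absurd (hs.lt_of_mem m ?_) (not_lt.2 (h z (by simp)).le)
        rw [List.mem_take_iff_getElem]
        exact ⟨t.length, by simp; omega, by simp⟩
    · intro hs
      have := hs.two_mul_le_length
      omega

/-- No match crosses into m, and the descent to m supplies the extra y of the exponent 1 + des for
the second factor. -/
theorem avoidWeight_append {a m : ℕ} (ha : 1 ≤ a) {l₁ l₂ : List ℕ} (h : ∀ u ∈ l₁, m < u) :
    avoidWeight a (l₁ ++ m :: l₂) = avoidWeight a l₁ * avoidWeight a (m :: l₂) := by
  induction l₁ with
  | nil => simp [avoidWeight]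
  | cons z₁ t ih =>
    have ih' := ih fun u hu => h u (List.mem_cons_of_mem _ hu)
    cases t with
    | nil =>
      rw [List.singleton_append, avoidWeight_of_descent ha (not_lt.2 (h z₁ (by simp)).le)]
      simp [avoidWeight]
    | cons z₂ t =>
      have hs := starts_append_iff ha (l₂ := l₂) (List.cons_ne_nil z₁ (z₂ :: t)) h
      simp only [List.cons_append] at ih' hs ⊢
      rw [avoidWeight, avoidWeight, ih']
      by_cases h1 : Starts a (z₁ :: z₂ :: t)
      · rw [if_pos (hs.2 h1), if_pos h1, zero_mul]
      · rw [if_neg (fun h2 => h1 (hs.1 h2)), if_neg h1, mul_assoc]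

/-- `x ^ LRmin * y ^ (1 + des)` for the words without match of `tau a`, and `0` for the others. -/
noncomputable def fullWeight (a : ℕ) (l : List ℕ) : Rxy :=
  x ^ lrCount l * Polynomial.C (avoidWeight a l)

open Classical in
/-- The restriction of `avoidWeight a` to the words whose first letter is the smallest one. -/
noncomputable def minHeadWeight (a : ℕ) (l : List ℕ) : Ry :=
  if ∃ z t, l = z :: t ∧ ∀ u ∈ t, z < u then avoidWeight a l else 0

theorem orderInvariant_fullWeight (a : ℕ) : OrderInvariant (fullWeight a) := by
  intro l f hf
  rw [fullWeight, fullWeight, orderInvariant_avoidWeight a l f hf]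
  cases l with
  | nil => rfl
  | cons z t => rw [List.map_cons, lrCount, lrCount, lrBelow_map hf]

theorem orderInvariant_minHeadWeight (a : ℕ) : OrderInvariant (minHeadWeight a) := by
  classical
  intro l f hf
  have h : (∃ z t, l.map f = z :: t ∧ ∀ u ∈ t, z < u) ↔ ∃ z t, l = z :: t ∧ ∀ u ∈ t, z < u := by
    cases l with
    | nil => simp
    | cons z t =>
      constructor
      · rintro ⟨z', t', he, h⟩
        rw [List.map_cons, List.cons.injEq] at he
        obtain ⟨rfl, rfl⟩ := he
        exact ⟨z, t, rfl, fun u hu => (hf z (by simp) u (List.mem_cons_of_mem _ hu)).2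
          (h _ (List.mem_map_of_mem hu))⟩
      · rintro ⟨z', t', he, h⟩
        rw [List.cons.injEq] at he
        obtain ⟨rfl, rfl⟩ := he
        refine ⟨f z, t.map f, rfl, fun u hu => ?_⟩
        obtain ⟨v, hv, rfl⟩ := List.mem_map.1 hu
        exact (hf z (by simp) v (List.mem_cons_of_mem _ hv)).1 (h v hv)
  rw [minHeadWeight, minHeadWeight, orderInvariant_avoidWeight a l f hf]
  exact if_congr h rfl rfl

open Classical in
theorem minHeadWeight_eq {a : ℕ} {S : Finset ℕ} (h0 : 0 ∈ S) {l : List ℕ} (hl : l ∈ words S) :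
    minHeadWeight a l = if ∃ t, l = 0 :: t then avoidWeight a l else 0 := by
  rw [minHeadWeight]
  refine if_congr ?_ rfl rfl
  constructor
  · rintro ⟨z, t, rfl, h⟩
    have h1 := (mem_of_mem_words hl).2 h0
    rw [List.mem_cons] at h1
    rcases h1 with rfl | h1
    · exact ⟨t, rfl⟩
    · exact absurd (h 0 h1) (Nat.not_lt_zero z)
  · rintro ⟨t, rfl⟩
    refine ⟨0, t, rfl, fun u hu => ?_⟩
    have := (List.nodup_cons.1 (mem_words.1 hl).1).1
    exact Nat.pos_of_ne_zero fun h => this (h ▸ hu)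

-- Only the cut just before the letter 0 contributes, and 0 is the last left-to-right minimum.
open Classical in
theorem fullWeight_eq_sum_splits {a : ℕ} (ha : 1 ≤ a) {S : Finset ℕ} (h0 : 0 ∈ S) {l : List ℕ}
    (hl : l ∈ words S) : fullWeight a l = ∑ k ∈ range (l.length + 1),
      x * fullWeight a (l.take k) *
        Polynomial.C (if ∃ t, l.drop k = 0 :: t then avoidWeight a (l.drop k) else 0) := by
  obtain ⟨l₁, l₂, rfl⟩ := List.append_of_mem ((mem_of_mem_words hl).2 h0)
  have hn := (mem_words.1 hl).1
  have h1 : ∀ u ∈ l₁, 0 < u := fun u hu =>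
    Nat.pos_of_ne_zero fun h => (List.nodup_append'.1 hn).2.2 (h ▸ hu) (by simp)
  rw [sum_eq_single l₁.length]
  · rw [List.take_left, List.drop_left, if_pos ⟨l₂, rfl⟩, fullWeight, fullWeight,
      lrCount_append_zero h1, avoidWeight_append ha h1, Polynomial.C_mul, pow_succ]
    ring
  · intro k hk hne
    rw [if_neg, Polynomial.C_0, mul_zero]
    rintro ⟨t, ht⟩
    have hk' : k < (l₁ ++ 0 :: l₂).length := by
      by_contra hk'
      rw [List.drop_eq_nil_of_le (by omega)] at ht
      exact absurd ht (by simp)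
    rw [List.drop_eq_getElem_cons hk', List.cons.injEq] at ht
    have h2 : (l₁ ++ 0 :: l₂)[l₁.length]'(by simp) = 0 := by simp
    exact hne ((hn.getElem_inj_iff).1 (ht.1.trans h2.symm))
  · intro h
    exact absurd (mem_range.2 (by rw [List.length_append]; omega)) h

theorem fullSum_succ {a : ℕ} (ha : 1 ≤ a) (n : ℕ) :
    wordSum (fullWeight a) (range (n + 1)) = ∑ k ∈ range (n + 1), (n.choose k : Rxy) *
      (x * wordSum (fullWeight a) (range k) *
        Polynomial.C (wordSum (minHeadWeight a) (range (n - k + 1)))) := by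
  classical
  have h0 : 0 ∈ range (n + 1) := by simp
  rw [wordSum_congr fun l hl => fullWeight_eq_sum_splits ha h0 hl,
    wordSum_splits fun l₁ l₂ => x * fullWeight a l₁ *
      Polynomial.C (if ∃ t, l₂ = 0 :: t then avoidWeight a l₂ else 0)]
  have hcard : #((range (n + 1)).erase 0) = n := by rw [card_erase_of_mem h0, card_range]; omega
  have h1 := sum_powerset_apply_card (fun k => x * wordSum (fullWeight a) (range k) *
        Polynomial.C (wordSum (minHeadWeight a) (range (n - k + 1)))) (x := (range (n + 1)).erase 0)
  rw [hcard] at h1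
  simp only [nsmul_eq_mul] at h1
  rw [← h1]
  symm
  -- The set T of letters before the cut must omit 0, which leaves n letters to choose from and
  -- explains `n.choose k`.
  refine sum_subset_zero_on_sdiff (powerset_mono.2 (erase_subset _ _)) ?_ ?_
  · intro T hT
    rw [mem_sdiff, mem_powerset, mem_powerset] at hT
    have hT0 : 0 ∈ T := by
      by_contra h
      exact hT.2 fun u hu => mem_erase.2 ⟨fun h' => h (h' ▸ hu), hT.1 hu⟩
    refine sum_eq_zero fun l₁ _ => sum_eq_zero fun l₂ hl₂ => ?_
    rw [if_neg, Polynomial.C_0, mul_zero]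
    rintro ⟨t, rfl⟩
    have := (mem_of_mem_words hl₂ (z := 0)).1 (by simp)
    rw [mem_sdiff] at this
    exact this.2 hT0
  · intro T hT
    rw [mem_powerset] at hT
    have hT0 : 0 ∈ range (n + 1) \ T :=
      mem_sdiff.2 ⟨h0, fun h => (mem_erase.1 (hT h)).1 rfl⟩
    have hTs : T ⊆ range (n + 1) := hT.trans (erase_subset _ _)
    have hTc : #T ≤ n := hcard ▸ card_le_card hT
    have h2 : #(range (n + 1) \ T) = n - #T + 1 := by
      rw [card_sdiff_of_subset hTs, card_range]
      omega
    rw [← h2, ← (orderInvariant_fullWeight a).wordSum_eq T,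
      ← (orderInvariant_minHeadWeight a).wordSum_eq (range (n + 1) \ T),
      wordSum_congr fun l hl => minHeadWeight_eq hT0 hl]
    unfold wordSum
    simp only [map_sum, mul_sum, sum_mul]
    rw [sum_comm]

theorem eval_fullSum (a n : ℕ) :
    Polynomial.eval 1 (wordSum (fullWeight a) (range n)) = wordSum (avoidWeight a) (range n) := by
  unfold wordSum
  rw [Polynomial.eval_finsetSum]
  refine sum_congr rfl fun l _ => ?_
  simp [fullWeight]

theorem derivative_egf_fullSum {a : ℕ} (ha : 1 ≤ a) :
    PowerSeries.derivative Rxy (egf fun n => wordSum (fullWeight a) (range n)) =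
      PowerSeries.C x *
        PowerSeries.map Polynomial.C (egf fun n => wordSum (minHeadWeight a) (range (n + 1))) *
        egf fun n => wordSum (fullWeight a) (range n) := by
  have h1 : PowerSeries.map (Polynomial.C : Ry →+* Rxy)
      (egf fun n => wordSum (minHeadWeight a) (range (n + 1))) =
      egf fun n => Polynomial.C (wordSum (minHeadWeight a) (range (n + 1))) := by
    ext1 n
    rw [PowerSeries.coeff_map, coeff_egf, coeff_egf, Polynomial.smul_C]
  rw [derivative_egf, h1, mul_assoc, mul_comm (egf _) (egf _), egf_mul_egf]
  ext1 n
  rw [PowerSeries.coeff_C_mul, coeff_egf, coeff_egf, fullSum_succ ha, mul_smul_comm, mul_sum]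
  refine congrArg _ (sum_congr rfl fun k _ => ?_)
  ring

theorem derivative_egf_avoidSum {a : ℕ} (ha : 1 ≤ a) :
    PowerSeries.derivative Ry (egf fun n => wordSum (avoidWeight a) (range n)) =
      (egf fun n => wordSum (minHeadWeight a) (range (n + 1))) *
        egf fun n => wordSum (avoidWeight a) (range n) := by
  rw [derivative_egf, mul_comm, egf_mul_egf]
  congr 1
  ext1 n
  have h := congrArg (Polynomial.eval 1) (fullSum_succ ha n)
  rw [Polynomial.eval_finsetSum] at h
  simpa [eval_fullSum] using h

theorem derivative_map_C (f : PowerSeries Ry) :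
    PowerSeries.derivative Rxy (PowerSeries.map Polynomial.C f) =
      PowerSeries.map Polynomial.C (PowerSeries.derivative Ry f) := by
  ext1 n
  rw [PowerSeries.coeff_derivative, PowerSeries.coeff_map, PowerSeries.coeff_map,
    PowerSeries.coeff_derivative]
  simp

theorem egf_fullSum_eq_formalPow {a : ℕ} (ha : 1 ≤ a) :
    (egf fun n => wordSum (fullWeight a) (range n)) = formalPow (PowerSeries.map Polynomial.C
      (egf fun n => wordSum (avoidWeight a) (range n))) x := by
  set F : PowerSeries Rxy := PowerSeries.map Polynomial.C
      (egf fun n => wordSum (avoidWeight a) (range n)) with hF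
  have hF1 : PowerSeries.constantCoeff F = 1 := by
    rw [hF, ← PowerSeries.coeff_zero_eq_constantCoeff_apply, PowerSeries.coeff_map, coeff_egf,
      wordSum_range_zero]
    simp [avoidWeight]
  refine eq_of_derivative_eq_mul ?_ (derivative_egf_fullSum ha) ?_
  · rw [constantCoeff_formalPow hF1, ← PowerSeries.coeff_zero_eq_constantCoeff_apply, coeff_egf,
      wordSum_range_zero]
    simp [fullWeight, lrCount, avoidWeight]
  · have h1 := mul_derivative_formalPow hF1 x
    have hF0 : F ≠ 0 := by
      intro h
      rw [h, map_zero] at hF1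
      exact zero_ne_one hF1
    -- The equation for the formal power is known only after multiplication by F, which can be
    -- cancelled in this integral domain.
    apply mul_left_cancel₀ hF0
    rw [h1, hF, derivative_map_C, derivative_egf_avoidSum ha, map_mul]
    ring

/-! ### From permutations to words -/

/-- The letters of `tau m` as a function on the natural numbers. -/
def tauVal (m p : ℕ) : ℕ := if p % 2 = 0 then p / 2 else 2 * m - 1 - p / 2

theorem tau_apply_val (m : ℕ) (p : Fin (2 * m)) : (tau m p : ℕ) = tauVal m p := by
  rw [tau, Equiv.ofBijective_apply, tauFun, tauVal]
  split_ifs <;> rfl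

/-- The second letter of a copy of `tau (k + 1)` is larger than its other letters. -/
theorem Starts.lt_second {k z₁ z₂ : ℕ} {t : List ℕ} (h : Starts (k + 1) (z₁ :: z₂ :: t)) :
    ∀ u ∈ z₁ :: t.take (2 * k), u < z₂ := by
  induction k generalizing z₁ z₂ t with
  | zero => simpa [starts_one] using h
  | succ k ih =>
    obtain ⟨_, _, z₃, z₄, s, hs, h1, h2, h3⟩ := starts_add_two_iff.1 h
    simp only [List.cons.injEq] at hs
    obtain ⟨rfl, rfl, rfl⟩ := hs
    have h4 := ih h3
    have h5 := starts_one.1 (h.mono (m' := 1) (by omega))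
    intro u hu
    rw [show 2 * (k + 1) = 2 * k + 2 by ring] at hu
    simp only [List.take_succ_cons, List.mem_cons] at hu
    rcases hu with rfl | rfl | rfl | hu
    · exact h5
    · exact (h4 _ (by simp)).trans h2
    · exact h2
    · exact (h4 u (List.mem_cons_of_mem _ hu)).trans h2

/-- The inequalities between neighbouring pairs suffice: the first letter is the smallest and the
second the largest, and the rest is a smaller copy. -/
theorem starts_iff_getD (m : ℕ) (l : List ℕ) : Starts m l ↔ 2 * m ≤ l.length ∧
    ∀ p q, p < 2 * m → q < 2 * m → tauVal m p < tauVal m q → l.getD p 0 < l.getD q 0 := by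
  have hmem : ∀ (t : List ℕ) (i k : ℕ), i < k → k ≤ t.length → t.getD i 0 ∈ t.take k := by
    intro t i k h1 h2
    rw [List.mem_take_iff_getElem]
    exact ⟨i, by omega, by rw [List.getD_eq_getElem]⟩
  -- Without its first two positions `tau (m + 1)` is `tau m` with every letter raised by one.
  have hstep : ∀ (m p q : ℕ), p < 2 * m → q < 2 * m →
      (tauVal (m + 1) (p + 2) < tauVal (m + 1) (q + 2) ↔ tauVal m p < tauVal m q) := by
    intro m p q hp hq
    unfold tauVal
    split_ifs <;> omega
  constructor
  · intro h
    refine ⟨h.two_mul_le_length, ?_⟩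
    induction m generalizing l with
    | zero => intro p q hp; omega
    | succ m ih =>
      have hlen := h.two_mul_le_length
      match l, hlen with
      | z₁ :: z₂ :: t, hlen =>
        simp only [List.length_cons] at hlen
        have hlt := h.lt_of_mem
        have hgt := h.lt_second
        rw [List.take_succ_cons] at hlt
        have ht : Starts m t := by
          have := h.drop (j := 1)
          simpa using this
        intro p q hp hq hpq
        match p, q with
        | 0, 0 => omega
        | 0, 1 => simpa using hgt z₁ (by simp)
        | 0, q + 2 =>
          simpa using hlt _ (List.mem_cons_of_mem _ (hmem t q (2 * m) (by omega) (by omega)))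
        | p + 2, 1 =>
          simpa using hgt _ (List.mem_cons_of_mem _ (hmem t p (2 * m) (by omega) (by omega)))
        | p + 2, q + 2 =>
          have := ih t ht p q (by omega) (by omega) ((hstep m p q (by omega) (by omega)).1 hpq)
          simpa using this
        | 1, q =>
          have h1 : tauVal (m + 1) 1 = 2 * m + 1 := by simp [tauVal]; omega
          have h2 : tauVal (m + 1) q ≤ 2 * m + 1 := by unfold tauVal; split_ifs <;> omega
          omega
        | p + 2, 0 => simp [tauVal] at hpq
  · rintro ⟨hlen, h⟩
    induction m generalizing l with
    | zero => exact starts_zero l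
    | succ m ih =>
      match m, l, hlen with
      | 0, z₁ :: z₂ :: t, _ =>
        have := h 0 1 (by omega) (by omega) (by decide)
        exact starts_one.2 (by simpa using this)
      | m + 1, z₁ :: z₂ :: z₃ :: z₄ :: t, hlen =>
        have h1 := h 0 2 (by omega) (by omega) (by unfold tauVal; simp)
        have h2 := h 3 1 (by omega) (by omega) (by unfold tauVal; simp; omega)
        refine starts_add_two.2 ⟨by simpa using h1, by simpa using h2, ih _ ?_ ?_⟩
        · simp only [List.length_cons] at hlen ⊢
          omega
        · intro p q hp hq hpq
          have := h (p + 2) (q + 2) (by omega) (by omega) ((hstep (m + 1) p q hp hq).2 hpq)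
          simpa using this

/-- One implication is enough since τ is injective into a total order: the positions with letter at
most w p are the preimage of the initial segment up to τ p. -/
theorem red_eq_letter_iff {m : ℕ} (τ : Equiv.Perm (Fin m)) (w : Fin m → ℕ) :
    red w = letter τ ↔ ∀ p q, τ p < τ q → w p < w q := by
  constructor
  · intro h p q hpq
    by_contra hcon
    have h1 : red w q ≤ red w p := by
      refine card_le_card fun r hr => ?_
      rw [mem_filter] at hr ⊢
      exact ⟨hr.1, by omega⟩
    rw [h, letter, letter] at h1
    have := Fin.lt_def.1 hpq
    omega
  · intro h
    funext p
    have h1 : (univ.filter fun q : Fin m => w q ≤ w p) = (Iic (τ p)).map τ.symm.toEmbedding := by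
      ext q
      rw [mem_filter, mem_map_equiv, Equiv.symm_symm, mem_Iic]
      constructor
      · rintro ⟨-, h2⟩
        by_contra h3
        exact absurd (h p q (not_le.1 h3)) (not_lt.2 h2)
      · intro h2
        refine ⟨mem_univ _, ?_⟩
        rcases h2.eq_or_lt with h3 | h3
        · rw [τ.injective h3]
        · exact (h q p h3).le
    rw [red, h1, card_map, Fin.card_Iic, letter]

/-- The word of a permutation, with letters counted from `0`. -/
def permWord {n : ℕ} (σ : Equiv.Perm (Fin n)) : List ℕ := List.ofFn fun i => (σ i : ℕ)

theorem matchAt_tau_iff (a : ℕ) {n : ℕ} (σ : Equiv.Perm (Fin n)) (i : ℕ) (ha : 1 ≤ a) :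
    MatchAt (tau a) σ i ↔ Starts a ((permWord σ).drop i) := by
  rw [starts_iff_getD, MatchAt, List.length_drop, permWord, List.length_ofFn]
  have key : ∀ (h : i + 2 * a ≤ n) (p : Fin (2 * a)),
      letter σ ⟨i + p, by have := p.isLt; omega⟩ =
        ((List.ofFn fun i => (σ i : ℕ)).drop i).getD p 0 + 1 := by
    intro h p
    have := p.isLt
    rw [List.getD_eq_getElem _ _ (by rw [List.length_drop, List.length_ofFn]; omega)]
    simp [letter]
  constructor
  · rintro ⟨h, h1⟩
    refine ⟨by omega, fun p q hp hq hpq => ?_⟩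
    have h2 := (red_eq_letter_iff _ _).1 h1 ⟨p, hp⟩ ⟨q, hq⟩
      (by rw [Fin.lt_def, tau_apply_val, tau_apply_val]; exact hpq)
    simp only at h2
    rw [key h ⟨p, hp⟩, key h ⟨q, hq⟩] at h2
    exact Nat.lt_of_add_lt_add_right h2
  · rintro ⟨h, h1⟩
    have h' : i + 2 * a ≤ n := by omega
    refine ⟨h', (red_eq_letter_iff _ _).2 fun p q hpq => ?_⟩
    rw [Fin.lt_def, tau_apply_val, tau_apply_val] at hpq
    rw [key h' p, key h' q]
    exact Nat.add_lt_add_right (h1 p q p.isLt q.isLt hpq) 1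

theorem mch_tau_eq_zero_iff {a : ℕ} (ha : 1 ≤ a) {n : ℕ} (σ : Equiv.Perm (Fin n)) :
    mch (tau a) σ = 0 ↔ ¬ ∃ i, Starts a ((permWord σ).drop i) := by
  classical
  rw [mch, card_eq_zero, filter_eq_empty_iff]
  constructor
  · rintro h ⟨i, hi⟩
    refine h ?_ ((matchAt_tau_iff a σ i ha).2 hi)
    have := hi.two_mul_le_length
    rw [List.length_drop, permWord, List.length_ofFn] at this
    rw [mem_range]
    omega
  · intro h i _ hi
    exact h ⟨i, (matchAt_tau_iff a σ i ha).1 hi⟩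

/-- The number of descents of a word. -/
def desCount : List ℕ → ℕ
  | [] => 0
  | [_] => 0
  | z₁ :: z₂ :: t => (if z₁ < z₂ then 0 else 1) + desCount (z₂ :: t)

open Classical in
theorem avoidWeight_eq {a : ℕ} (ha : 1 ≤ a) {l : List ℕ} (hl : l ≠ []) : avoidWeight a l =
    if ∃ i, Starts a (l.drop i) then 0 else y ^ (1 + desCount l) := by
  induction l with
  | nil => exact absurd rfl hl
  | cons z₁ t ih =>
    cases t with
    | nil =>
      rw [if_neg]
      · simp [avoidWeight, desCount]
      · rintro ⟨i, hi⟩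
        have := hi.two_mul_le_length
        simp at this
        omega
    | cons z₂ t =>
      have h1 : (∃ i, Starts a ((z₁ :: z₂ :: t).drop i)) ↔
          Starts a (z₁ :: z₂ :: t) ∨ ∃ i, Starts a ((z₂ :: t).drop i) := by
        constructor
        · rintro ⟨_ | i, hi⟩
          · exact Or.inl hi
          · exact Or.inr ⟨i, hi⟩
        · rintro (h | ⟨i, hi⟩)
          · exact ⟨0, h⟩
          · exact ⟨i + 1, hi⟩
      rw [avoidWeight, ih (List.cons_ne_nil _ _), desCount]
      by_cases h2 : Starts a (z₁ :: z₂ :: t)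
      · rw [if_pos h2, if_pos (h1.2 (Or.inl h2))]
      · by_cases h3 : ∃ i, Starts a ((z₂ :: t).drop i)
        · rw [if_neg h2, if_pos h3, if_pos (h1.2 (Or.inr h3)), mul_zero]
        · rw [if_neg h2, if_neg h3, if_neg (fun h => (h1.1 h).elim h2 h3)]
          split_ifs
          · rw [one_mul, zero_add]
          · ring

open Classical in
theorem desCount_ofFn {n : ℕ} (g : Fin n → ℕ) (hg : Function.Injective g) :
    desCount (List.ofFn g) =
      #{i : Fin n | ∃ h : (i : ℕ) + 1 < n, g ⟨(i : ℕ) + 1, h⟩ < g i} := by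
  induction n with
  | zero => simp [desCount]
  | succ n ih =>
    cases n with
    | zero =>
      rw [List.ofFn_succ, List.ofFn_zero, desCount, eq_comm, card_eq_zero, filter_eq_empty_iff]
      rintro i - ⟨h, -⟩
      omega
    | succ n =>
      have h1 := ih (fun i => g i.succ) (hg.comp (Fin.succ_injective _))
      rw [List.ofFn_succ] at h1
      rw [List.ofFn_succ, List.ofFn_succ, desCount, h1]
      have hne : g 0 ≠ g (Fin.succ 0) := fun h => absurd (hg h) (Fin.succ_ne_zero 0).symm
      have h2 := Fin.card_filter_univ_succ (fun i : Fin (n + 1 + 1) =>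
        ∃ h : (i : ℕ) + 1 < n + 1 + 1, g ⟨(i : ℕ) + 1, h⟩ < g i)
      have h3 : #{i : Fin (n + 1) | ∃ h : (i : ℕ) + 1 < n + 1,
            g (Fin.succ ⟨(i : ℕ) + 1, h⟩) < g i.succ} =
          #{i : Fin (n + 1) | ∃ h : (i.succ : ℕ) + 1 < n + 1 + 1,
            g ⟨(i.succ : ℕ) + 1, h⟩ < g i.succ} := by
        congr 1
        ext i
        simp only [mem_filter, mem_univ, true_and]
        constructor
        · rintro ⟨h, h'⟩
          exact ⟨by rw [Fin.val_succ]; omega, h'⟩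
        · rintro ⟨h, h'⟩
          exact ⟨by rw [Fin.val_succ] at h; omega, h'⟩
      rw [h2, h3]
      by_cases h4 : g 0 < g (Fin.succ 0)
      · rw [if_pos h4, if_neg, zero_add]
        rintro ⟨_, h⟩
        exact lt_asymm h4 h
      · rw [if_neg h4, if_pos, add_comm]
        exact ⟨by rw [Fin.val_zero]; omega, lt_of_le_of_ne (not_lt.1 h4) hne.symm⟩

open Classical in
theorem lrBelow_ofFn {n : ℕ} (b : ℕ) (g : Fin n → ℕ) : lrBelow b (List.ofFn g) =
    #{j : Fin n | g j < b ∧ ∀ i : Fin n, i < j → g j < g i} := by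
  induction n generalizing b with
  | zero => simp [lrBelow]
  | succ n ih =>
    rw [List.ofFn_succ, lrBelow, ih, ih, Fin.card_filter_univ_succ]
    simp only [Fin.forall_fin_succ, Fin.succ_lt_succ_iff, Fin.succ_pos,
      Fin.not_lt_zero, forall_true_left, IsEmpty.forall_iff, implies_true, and_true]
    split_ifs with h
    · rw [add_comm]
      congr 2
      ext j
      simp only [mem_filter, mem_univ, true_and]
      constructor
      · rintro ⟨h1, h2⟩
        exact ⟨h1.trans h, h1, h2⟩
      · rintro ⟨-, h1, h2⟩
        exact ⟨h1, h2⟩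
    · congr 1
      ext j
      simp only [mem_filter, mem_univ, true_and]
      constructor
      · rintro ⟨h1, h2⟩
        exact ⟨h1, by omega, h2⟩
      · rintro ⟨h1, -, h2⟩
        exact ⟨h1, h2⟩

theorem desCount_permWord {n : ℕ} (σ : Equiv.Perm (Fin n)) : desCount (permWord σ) = des σ := by
  rw [permWord, desCount_ofFn (fun i => (σ i : ℕ)) (Fin.val_injective.comp σ.injective), des]
  rfl

theorem lrCount_permWord {n : ℕ} (σ : Equiv.Perm (Fin n)) : lrCount (permWord σ) = lrmin σ := by
  have h : ∀ l : List ℕ, (∀ u ∈ l, u < n) → lrCount l = lrBelow n l := by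
    intro l hl
    cases l with
    | nil => rfl
    | cons z t => rw [lrCount, lrBelow, if_pos (hl z (by simp))]
  rw [h, permWord, lrBelow_ofFn, lrmin]
  · congr 1
    ext j
    simp
  · intro u hu
    obtain ⟨i, rfl⟩ := List.mem_ofFn.1 hu
    exact (σ i).isLt

theorem sum_permWord {R : Type*} [CommRing R] (w : List ℕ → R) (n : ℕ) :
    ∑ σ : Equiv.Perm (Fin n), w (permWord σ) = wordSum w (range n) := by
  refine sum_bij (fun σ _ => permWord σ) ?_ ?_ ?_ ?_
  · intro σ _
    rw [mem_words]
    refine ⟨List.nodup_ofFn.2 (Fin.val_injective.comp σ.injective), ?_⟩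
    ext u
    rw [List.mem_toFinset, permWord, List.mem_ofFn, mem_range]
    constructor
    · rintro ⟨i, rfl⟩
      exact (σ i).isLt
    · intro hu
      exact ⟨σ.symm ⟨u, hu⟩, by simp⟩
  · intro σ _ σ' _ h
    have := List.ofFn_injective h
    ext i
    exact congrFun this i
  · intro l hl
    have hlen := length_of_mem_words hl
    rw [card_range] at hlen
    subst hlen
    have hlt : ∀ i : Fin l.length, l[i] < l.length := fun i =>
      mem_range.1 ((mem_of_mem_words hl).1 (List.getElem_mem _))
    have hinj : Function.Injective (fun i : Fin l.length => (⟨l[i], hlt i⟩ : Fin l.length)) := by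
      intro i j hij
      rw [Fin.mk.injEq] at hij
      exact Fin.ext ((mem_words.1 hl).1.getElem_inj_iff.1 hij)
    refine ⟨Equiv.ofBijective _ (Finite.injective_iff_bijective.1 hinj), mem_univ _, ?_⟩
    rw [permWord]
    simp
  · intros
    rfl

theorem NMpoly_tau {a : ℕ} (ha : 1 ≤ a) (n : ℕ) :
    NMpoly (tau a) n = wordSum (fullWeight a) (range n) := by
  classical
  cases n with
  | zero =>
    rw [wordSum_range_zero]
    simp [NMpoly, fullWeight, lrCount, avoidWeight]
  | succ n =>
    rw [NMpoly, noMatch, sum_filter, ← sum_permWord]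
    refine sum_congr rfl fun σ _ => ?_
    have hne : permWord σ ≠ [] := by
      rw [Ne, ← List.length_eq_zero_iff, permWord, List.length_ofFn]
      omega
    rw [fullWeight, avoidWeight_eq ha hne, lrCount_permWord, desCount_permWord]
    by_cases h : ∃ i, Starts a ((permWord σ).drop i)
    · rw [if_pos h, if_neg (fun h' => (mch_tau_eq_zero_iff ha σ).1 h' h), Polynomial.C_0, mul_zero]
    · rw [if_neg h, if_pos ((mch_tau_eq_zero_iff ha σ).2 h)]

theorem invOfUnit_eq_of_mul_eq_one {R : Type*} [CommRing R] {F G : PowerSeries R}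
    (h : F * G = 1) (hG : PowerSeries.constantCoeff G = 1) : PowerSeries.invOfUnit G 1 = F := by
  have h1 : G * PowerSeries.invOfUnit G 1 = 1 := PowerSeries.mul_invOfUnit G 1 (by simpa using hG)
  -- Left and right inverses of G coincide.
  calc PowerSeries.invOfUnit G 1 = F * G * PowerSeries.invOfUnit G 1 := by rw [h, one_mul]
    _ = F := by rw [mul_assoc, h1, mul_one]

theorem U_tau {a : ℕ} (ha : 1 ≤ a) : U (tau a) = egf (recipSum a) := by
  have h : (fun n => Polynomial.eval 1 (NMpoly (tau a) n)) =
      fun n => wordSum (avoidWeight a) (range n) := by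
    funext n
    rw [NMpoly_tau ha, eval_fullSum]
  rw [U, h]
  refine invOfUnit_eq_of_mul_eq_one (egf_recipSum_mul ha) ?_
  rw [← PowerSeries.coeff_zero_eq_constantCoeff_apply, coeff_egf, wordSum_range_zero]
  simp [avoidWeight]

theorem Upoly_tau {a : ℕ} (ha : 1 ≤ a) : Upoly (tau a) = recipSum a := by
  funext n
  rw [Upoly, U_tau ha, factorial_smul_coeff_egf]

theorem NM_tau {a : ℕ} (ha : 1 ≤ a) : NM (tau a) = formalPow (PowerSeries.invOfUnit
    (PowerSeries.map (Polynomial.C : Ry →+* Rxy) (U (tau a))) 1) x := by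
  have h : NMpoly (tau a) = fun n => wordSum (fullWeight a) (range n) :=
    funext fun n => NMpoly_tau ha n
  rw [NM, h, egf_fullSum_eq_formalPow ha, U_tau ha]
  congr 1
  symm
  refine invOfUnit_eq_of_mul_eq_one ?_ ?_
  · rw [← map_mul, mul_comm, egf_recipSum_mul ha, map_one]
  · rw [← PowerSeries.coeff_zero_eq_constantCoeff_apply, PowerSeries.coeff_map, coeff_egf,
      recipSum_zero]
    simp

end ConsecutivePattern

/-- `n / (2 * a)` is the number of `k ≥ 0` with `k ≤ ⌊(n - 2a) / (2a)⌋`, and `(n - 2) / (2 * a)`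
that of `k ≥ 0` with `k ≤ ⌊(n - 2a - 2) / (2a)⌋`; for these `k` no subtraction is truncated. -/
theorem mainTheorem3 (a : ℕ) (ha : 2 ≤ a) :
    ConsecutivePattern.NM (ConsecutivePattern.tau a) =
      ConsecutivePattern.formalPow
        (PowerSeries.invOfUnit
          (PowerSeries.map (Polynomial.C : ConsecutivePattern.Ry →+* ConsecutivePattern.Rxy)
            (ConsecutivePattern.U (ConsecutivePattern.tau a))) 1)
        ConsecutivePattern.x ∧
    ConsecutivePattern.U (ConsecutivePattern.tau a) =
      ConsecutivePattern.egf (ConsecutivePattern.Upoly (ConsecutivePattern.tau a)) ∧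
    ConsecutivePattern.Upoly (ConsecutivePattern.tau a) 0 = 1 ∧
    ConsecutivePattern.Upoly (ConsecutivePattern.tau a) 1 = -ConsecutivePattern.y ∧
    ∀ n : ℕ, 2 ≤ n →
      ConsecutivePattern.Upoly (ConsecutivePattern.tau a) n =
        (1 - ConsecutivePattern.y) *
            ConsecutivePattern.Upoly (ConsecutivePattern.tau a) (n - 1) -
          ∑ k ∈ Finset.range (n / (2 * a)),
            ((n - (k + 1) * a - 1).choose ((k + 1) * a - 1) : ConsecutivePattern.Ry) *
              ConsecutivePattern.y ^ ((k + 1) * a - 1) *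
              ConsecutivePattern.Upoly (ConsecutivePattern.tau a) (n - 2 * (k + 1) * a + 1) +
          ∑ k ∈ Finset.range ((n - 2) / (2 * a)),
            ((n - (k + 1) * a - 2).choose ((k + 1) * a) : ConsecutivePattern.Ry) *
              ConsecutivePattern.y ^ ((k + 1) * a) *
              ConsecutivePattern.Upoly (ConsecutivePattern.tau a)
                (n - 2 * (k + 1) * a - 1) := by
  have ha1 : 1 ≤ a := by omega
  refine ⟨ConsecutivePattern.NM_tau ha1, ?_, ?_, ?_, ?_⟩
  · rw [ConsecutivePattern.Upoly_tau ha1, ConsecutivePattern.U_tau ha1]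
  · rw [ConsecutivePattern.Upoly_tau ha1, ConsecutivePattern.recipSum_zero]
  · rw [ConsecutivePattern.Upoly_tau ha1, ConsecutivePattern.recipSum_one]
  · rw [ConsecutivePattern.Upoly_tau ha1]
    exact ConsecutivePattern.recipSum_eq a ha1
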